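/- Let $\mathbb{T}=\mathbb{R}/2\pi\mathbb{Z}$ and let $\Gamma\in\mathbb{R}$. For $s\in\mathbb{R}$ let $X^s$ be the space of real-valued (generalized) functions $U(\zeta,\phi)=\sum_{p\text{ odd}}U_p(\zeta)e^{ip\phi}$ on $\mathbb{R}\times\mathbb{T}$ (so $U_{-p}=\bar U_p$ and all even modes vanish) with finite norm $$\|U\|_{X^s}=\Big(\sum_{p\text{ odd}}\int_{\mathbb{R}}(p^2+\xi^2)^s|\hat U_p(\xi)|^2\,d\xi\Big)^{1/2},$$ where $\hat U_p$ is the Fourier transform of $U_p$. For $s>1$ elements of $X^s$ are identified with their continuous representatives. Call $U$ reversible if $U_p(\zeta)=\bar U_p(-\zeta)$ for all odd $p$. Fix $s>1$. Let $U\in X^s$ be a reversible solution of the extended nonlinear Schrödinger system (xNLS) $$U_p''-p^2U_p+\tfrac{2p^2}{3}\Gamma\Big(3U_p\sum_{q\text{ odd}}|U_q|^2+\sum_{q,r\text{ odd}}U_qU_rU_{p-q-r}\Big)=0,\qquad p\text{ odd},$$ equivalently of $(\partial_\zeta^2+\partial_\phi^2)U=\frac23\Gamma\,\partial_\phi^2\big[U^3+3\big(\frac1{2\pi}\int_{-\pi}^{\pi}|U(\zeta,\theta)|^2d\theta\big)U\big]$.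 Assume that the linearization of this system at $U$ is invertible, with bounded inverse, from the reversible subspace of $X^s$ onto the reversible subspace of $X^{s-2}$. Then there are $\mu_0>0$ and $C>0$ such that for every $\mu\in(-\mu_0,\mu_0)$ the stationary extended coupled mode system (xNLCME) with $\Omega=\sqrt{1-\mu^2}$, $$iA_p'+p\,\Omega A_p+pB_p+\tfrac{p\Gamma}{3}\Big(3A_p\sum_{q\text{ odd}}|B_q|^2+\sum_{q,r\text{ odd}}A_qA_rA_{p-q-r}\Big)=0,$$ $$-iB_p'+p\,\Omega B_p+pA_p+\tfrac{p\Gamma}{3}\Big(3B_p\sum_{q\text{ odd}}|A_q|^2+\sum_{q,r\text{ odd}}B_qB_rB_{p-q-r}\Big)=0,\qquad p\text{ odd},$$ has a unique solution $(A,B)$ with $A,B\in X^s$ that is reversible, $A_p(Z)=\bar A_p(-Z)$ and $B_p(Z)=\bar B_p(-Z)$, and satisfies $$\|A-\mu U(\mu\,\cdot,\cdot)\|+\|B+\mu U(\mu\,\cdot,\cdot)\|\le C\mu^2,$$ where the norms are $X^s$ norms in the slow variable $\zeta=\mu Z$; that is, $A(Z,\phi)=a(\mu Z,\phi)$ and $B(Z,\phi)=b(\mu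 Z,\phi)$ for some $a,b\in X^s$ with $\|a-\mu U\|_{X^s}+\|b+\mu U\|_{X^s}\le C\mu^2$. -/

import Mathlib

open MeasureTheory
open scoped SchwartzMap FourierTransform ENNReal ComplexConjugate

namespace GapSoliton

/-- The odd integers, indexing the Fourier modes in the periodic variable. -/
abbrev OddInt : Type := {p : ℤ // Odd p}

/-- The tempered distribution `T` is integration against the function `f`. -/
def Represents (T : 𝓢'(ℝ, ℂ)) (f : ℝ → ℂ) : Prop :=
  ∀ ψ : 𝓢(ℝ, ℂ), Integrable (fun x => ψ x * f x) ∧ T ψ = ∫ x, ψ x * f x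

/-! ### The spaces `X^s`

A (generalized) function `U(ζ, φ) = ∑ U_p(ζ) e^{ipφ}` on `ℝ × 𝕋` is handled through the family
`(U_p)` of its Fourier coefficients in `φ`. For general real `s` these are tempered distributions
on `ℝ`. For `s > 1` (where `H^s(ℝ × 𝕋)` consists of continuous functions) they are continuous
functions. -/

/-- The `X^s` norm `(∑_{p odd} ∫ (p² + ξ²)^s |Û_p(ξ)|² dξ)^{1/2}`, with values in `[0, ∞]`.
`Û_p` is the unitary Fourier transform with dual variable `ξ = 2πη`, where `η` is the variable of
Mathlib's Fourier transform. The infimum runs over all densities `g_p` of the Fourier transforms,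
which are unique up to null sets; the norm is `∞` if there are none. -/
noncomputable def xDistNorm (s : ℝ) (T : ℤ → 𝓢'(ℝ, ℂ)) : ℝ≥0∞ :=
  ⨅ (g : ℤ → ℝ → ℂ) (_ : ∀ p : ℤ, Odd p → Represents (𝓕 (T p)) (g p)),
    (∑' p : OddInt, ∫⁻ η : ℝ,
      ENNReal.ofReal ((((p : ℤ) : ℝ) ^ 2 + (2 * Real.pi * η) ^ 2) ^ s) * ‖g p η‖ₑ ^ 2) ^ (1 / 2 : ℝ)

/-- Membership in `X^s`, for every real `s`: finite norm, real-valuedness `U_{-p} = conj U_p`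
(for distributions, `U_{-p}(conj ψ) = conj (U_p(ψ))`), and vanishing even modes. -/
structure MemXDist (s : ℝ) (T : ℤ → 𝓢'(ℝ, ℂ)) : Prop where
  norm_lt_top : xDistNorm s T < ⊤
  real : ∀ (p : ℤ) (ψ χ : 𝓢(ℝ, ℂ)), (∀ x, χ x = conj (ψ x)) → T (-p) χ = conj (T p ψ)
  even_eq_zero : ∀ p : ℤ, Even p → T p = 0

/-- The `X^s` norm of a family of mode functions. The representing distributions are unique;
the norm is `∞` if the functions do not define tempered distributions. -/
noncomputable def xNorm (s : ℝ) (u : ℤ → ℝ → ℂ) : ℝ≥0∞ :=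
  ⨅ (T : ℤ → 𝓢'(ℝ, ℂ)) (_ : ∀ p, Represents (T p) (u p)), xDistNorm s T

/-- Membership of a family of mode functions in `X^s`, for `s > 1`. Asking for continuity selects
the continuous representative of each class. -/
structure MemX (s : ℝ) (u : ℤ → ℝ → ℂ) : Prop where
  continuous : ∀ p, Continuous (u p)
  norm_lt_top : xNorm s u < ⊤
  real : ∀ p x, u (-p) x = conj (u p x)
  even_eq_zero : ∀ p : ℤ, Even p → ∀ x, u p x = 0

/-- The reversibility symmetry `U_p(ζ) = conj U_p(-ζ)`. -/
def IsReversible (u : ℤ → ℝ → ℂ) : Prop :=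
  ∀ p : ℤ, Odd p → ∀ x, u p x = conj (u p (-x))

/-- The reversibility symmetry `U_p(ζ) = conj U_p(-ζ)` for distributions. -/
def IsReversibleDist (T : ℤ → 𝓢'(ℝ, ℂ)) : Prop :=
  ∀ p : ℤ, Odd p → ∀ ψ χ : 𝓢(ℝ, ℂ), (∀ x, χ x = conj (ψ (-x))) → T p χ = conj (T p ψ)

/-! ### The two stationary systems -/

/-- `3 A_p ∑_q |B_q|² + ∑_{q,r} A_q A_r A_{p-q-r}`, with sums over odd `q`, `r`. -/
noncomputable def cubic (A B : ℤ → ℝ → ℂ) (p : ℤ) (x : ℝ) : ℂ :=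
  3 * A p x * (∑' q : OddInt, (‖B q x‖ ^ 2 : ℝ) : ℝ)
    + ∑' qr : OddInt × OddInt, A qr.1 x * A qr.2 x * A (p - qr.1 - qr.2) x

/-- The stationary extended coupled mode system with `N_{2p} = 1` and frequency `Ω`:
`i A_p' + p Ω A_p + p B_p + p (Γ/3) (3 A_p ∑ |B_q|² + ∑∑ A_q A_r A_{p-q-r}) = 0` and
`-i B_p' + p Ω B_p + p A_p + p (Γ/3) (3 B_p ∑ |A_q|² + ∑∑ B_q B_r B_{p-q-r}) = 0`, `p` odd. -/
structure IsCoupledModeSolution (Γ Ω : ℝ) (A B : ℤ → ℝ → ℂ) : Prop where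
  differentiable_left : ∀ p : ℤ, Odd p → Differentiable ℝ (A p)
  differentiable_right : ∀ p : ℤ, Odd p → Differentiable ℝ (B p)
  left : ∀ p : ℤ, Odd p → ∀ Z : ℝ,
    Complex.I * deriv (A p) Z + p * Ω * A p Z + p * B p Z + p * (Γ / 3) * cubic A B p Z = 0
  right : ∀ p : ℤ, Odd p → ∀ Z : ℝ,
    -Complex.I * deriv (B p) Z + p * Ω * B p Z + p * A p Z + p * (Γ / 3) * cubic B A p Z = 0

/-- The extended nonlinear Schrödinger system
`U_p'' - p² U_p + (2p²/3) Γ (3 U_p ∑ |U_q|² + ∑∑ U_q U_r U_{p-q-r}) = 0`, `p` odd. -/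
structure IsNLSSolution (Γ : ℝ) (U : ℤ → ℝ → ℂ) : Prop where
  contDiff : ∀ p : ℤ, Odd p → ContDiff ℝ 2 (U p)
  eqn : ∀ p : ℤ, Odd p → ∀ ζ : ℝ,
    iteratedDeriv 2 (U p) ζ - (p : ℂ) ^ 2 * U p ζ
      + 2 * (p : ℂ) ^ 2 / 3 * Γ * cubic U U p ζ = 0

/-! ### The linearized operator -/

/-- The derivative of `U ↦ 3 U_p ∑ |U_q|² + ∑∑ U_q U_r U_{p-q-r}` at `U` in the direction `W`. -/
noncomputable def cubicDeriv (U W : ℤ → ℝ → ℂ) (p : ℤ) (x : ℝ) : ℂ :=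
  3 * W p x * (∑' q : OddInt, (‖U q x‖ ^ 2 : ℝ) : ℝ)
    + 3 * U p x * (∑' q : OddInt, 2 * (conj (U q x) * W q x).re : ℝ)
    + 3 * ∑' qr : OddInt × OddInt, U qr.1 x * U qr.2 x * W (p - qr.1 - qr.2) x

/-- `T = L_U W`, where `L_U` is the linearization at `U` of the extended nonlinear Schrödinger
system, `(L_U W)_p = W_p'' - p² W_p + (2p²/3) Γ (cubicDeriv U W)_p`, in the sense of tempered
distributions. -/
def IsLinearizedImage (Γ : ℝ) (U W : ℤ → ℝ → ℂ) (T : ℤ → 𝓢'(ℝ, ℂ)) : Prop :=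
  ∀ p : ℤ, Odd p → ∀ ψ : 𝓢(ℝ, ℂ),
    T p ψ = ∫ ζ : ℝ, (W p ζ * (iteratedDeriv 2 (fun x => ψ x) ζ - (p : ℂ) ^ 2 * ψ ζ)
      + 2 * (p : ℂ) ^ 2 / 3 * Γ * cubicDeriv U W p ζ * ψ ζ)

/-- `L_U`, from the reversible subspace of `X^s` to that of `X^{s-2}`, is bijective and its inverse
is bounded. -/
structure LinearizationInvertible (s Γ : ℝ) (U : ℤ → ℝ → ℂ) : Prop where
  bijective : ∀ T : ℤ → 𝓢'(ℝ, ℂ), MemXDist (s - 2) T → IsReversibleDist T →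
    ∃! W : ℤ → ℝ → ℂ, MemX s W ∧ IsReversible W ∧ IsLinearizedImage Γ U W T
  bounded : ∃ K : ℝ, ∀ (W : ℤ → ℝ → ℂ) (T : ℤ → 𝓢'(ℝ, ℂ)),
    MemX s W → IsReversible W → MemXDist (s - 2) T → IsReversibleDist T →
    IsLinearizedImage Γ U W T → xNorm s W ≤ ENNReal.ofReal K * xDistNorm (s - 2) T

/-- `‖A - μ U(μ·,·)‖ + ‖B + μ U(μ·,·)‖ ≤ δ`, where the `X^s` norms are taken in the slow variable
`ζ = μ Z`: `A(Z, φ) = a(μ Z, φ)` and `B(Z, φ) = b(μ Z, φ)` with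
`‖a - μ U‖ + ‖b + μ U‖ ≤ δ` in `X^s`. -/
def SlowClose (s μ : ℝ) (U A B : ℤ → ℝ → ℂ) (δ : ℝ) : Prop :=
  ∃ a b : ℤ → ℝ → ℂ, MemX s a ∧ MemX s b ∧
    (∀ p Z, A p Z = a p (μ * Z)) ∧ (∀ p Z, B p Z = b p (μ * Z)) ∧
    xNorm s (fun p ζ => a p ζ - μ * U p ζ) + xNorm s (fun p ζ => b p ζ + μ * U p ζ)
      ≤ ENNReal.ofReal δ

end GapSoliton

/-!
In the slow variable `ζ = μ Z`, put `A(Z) = μ a(μ Z)` and `B(Z) = -μ b(μ Z)`. The linear part of the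
coupled mode system then has, in the mode `p` at frequency `ξ`, determinant `-μ² (p² + ξ²)`. Inverting
it turns the system into a fixed point equation for `(a, b)` whose right-hand side consists of the
cubic terms filtered by the bounded symbols `p² / (p² + ξ²)` and `p ξ / (p² + ξ²)`, and which makes
sense at `μ = 0` as well. There it has the solution `a = b = U`. In the variables
`(a + b)/2` and `(a - b)/2` its linearization at this point is block diagonal: on the sums it is the
linearized Schrödinger operator composed with `(∂_ζ² + ∂_φ²)⁻¹`, on the differences it is the
identity. The implicit function theorem therefore gives a unique branch of solutions within `O(μ)`
of `(U, U)`.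

A real reversible function has a real Fourier transform, so the reversible subspace of `X^s` is a
closed subspace of a weighted `L²` space of real functions on `ℤ × ℝ`, in which products become
convolutions. For `s > 1` the inverse of the weight is integrable, which makes this space a
convolution algebra.
-/

namespace GapSoliton

open scoped Convolution

/-! ### Zeros bifurcating from a nondegenerate zero -/

section Branch

variable {T X Y E : Type*} [NormedAddCommGroup T] [NormedSpace ℝ T] [CompleteSpace T]
  [NormedAddCommGroup X] [NormedSpace ℝ X] [CompleteSpace X]
  [NormedAddCommGroup Y] [NormedSpace ℝ Y] [CompleteSpace Y]
  [NormedAddCommGroup E] [NormedSpace ℝ E]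

lemma isInvertible_of_bijective {L : X →L[ℝ] Y} (hL : Function.Bijective L) :
    L.IsInvertible :=
  ⟨.ofBijective L (LinearMap.ker_eq_bot.2 hL.1) (LinearMap.range_eq_top.2 hL.2),
    ContinuousLinearEquiv.coe_ofBijective L _ _⟩

theorem exists_unique_zero_near {f : T × X → Y} {t₀ : T} {x₀ : X} {L : X →L[ℝ] Y}
    (hf : ContDiffAt ℝ 1 f (t₀, x₀)) (hf₀ : f (t₀, x₀) = 0)
    (hL : HasFDerivAt (fun x => f (t₀, x)) L x₀) (hbij : Function.Bijective L) :
    ∃ C : ℝ, 0 < C ∧ ∀ C' : ℝ, ∃ r : ℝ, 0 < r ∧ ∀ t : T, ‖t - t₀‖ < r →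
      ∃ x : X, f (t, x) = 0 ∧ ‖x - x₀‖ ≤ C * ‖t - t₀‖ ∧
        ∀ y : X, f (t, y) = 0 → ‖y - x₀‖ ≤ C' * ‖t - t₀‖ → y = x := by
  have hinv : (fderiv ℝ f (t₀, x₀) ∘L .inr ℝ T X).IsInvertible := by
    have hpartial : HasFDerivAt (fun x => f (t₀, x)) (fderiv ℝ f (t₀, x₀) ∘L .inr ℝ T X) x₀ :=
      HasFDerivAt.comp (g := f) x₀ (hf.differentiableAt one_ne_zero).hasFDerivAt
        (hasFDerivAt_prodMk_right t₀ x₀)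
    rw [hpartial.unique hL]
    exact isInvertible_of_bijective hbij
  obtain ⟨C, hC, hbound⟩ :=
    (hf.hasStrictFDerivAt_implicitFunction one_ne_zero hinv).hasFDerivAt.isBigO_sub.exists_pos
  have hsol := hf.eventually_apply_implicitFunction one_ne_zero hinv
  have huniq := hf.eventually_apply_eq_iff_implicitFunction one_ne_zero hinv
  have hbase := hf.implicitFunction_apply_self one_ne_zero hinv
  set g := hf.implicitFunction one_ne_zero hinv
  simp only [hf₀] at hsol huniq
  refine ⟨C, hC, fun C' => ?_⟩
  obtain ⟨r₁, hr₁, hnear⟩ := Metric.eventually_nhds_iff.1 (hbound.bound.and hsol)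
  obtain ⟨r₂, hr₂, hiff⟩ := Metric.eventually_nhds_iff.1 huniq
  refine ⟨min r₁ (min r₂ (r₂ / (|C'| + 1))), by positivity, fun t ht => ?_⟩
  simp only [lt_min_iff] at ht
  obtain ⟨ht₁, ht₂, ht₃⟩ := ht
  obtain ⟨hgC, hg₀⟩ := hnear (y := t) (by rwa [dist_eq_norm])
  refine ⟨g t, hg₀, by simpa only [hbase] using hgC, fun y hy hyC => ?_⟩
  have hsmall : C' * ‖t - t₀‖ < r₂ := by
    rw [lt_div_iff₀ (by positivity)] at ht₃
    nlinarith [le_abs_self C', norm_nonneg (t - t₀)]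
  refine ((hiff (y := (t, y)) ?_).1 hy).symm
  rw [Prod.dist_eq, dist_eq_norm, dist_eq_norm]
  exact max_lt ht₂ (hyC.trans_lt hsmall)

lemma bijective_prod_sub_half {K : E →L[ℝ] E} (hK : Function.Bijective fun h => h - K h) :
    Function.Bijective fun x : E × E =>
      (x.1 - (1 / 2 : ℝ) • K (x.1 + x.2), x.2 - (1 / 2 : ℝ) • K (x.1 + x.2)) := by
  have hsum : ∀ {x y : E × E}, x.1 - (1 / 2 : ℝ) • K (x.1 + x.2) = y.1 →
      x.2 - (1 / 2 : ℝ) • K (x.1 + x.2) = y.2 → (x.1 + x.2) - K (x.1 + x.2) = y.1 + y.2 := by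
    intro x y h₁ h₂
    rw [← h₁, ← h₂]
    module
  refine ⟨fun x y hxy => ?_, fun y => ?_⟩
  · obtain ⟨h₁, h₂⟩ := Prod.ext_iff.1 hxy
    have hs : x.1 + x.2 = y.1 + y.2 := hK.1 ((hsum h₁ h₂).trans (by module))
    simp only [hs, sub_left_inj] at h₁ h₂
    exact Prod.ext h₁ h₂
  · obtain ⟨z, hz : z - K z = y.1 + y.2⟩ := hK.2 (y.1 + y.2)
    have hz' : (y.1 + (1 / 2 : ℝ) • K z) + (y.2 + (1 / 2 : ℝ) • K z) = z := by
      calc _ = (y.1 + y.2) + K z := by module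
        _ = z := by rw [← hz, sub_add_cancel]
    exact ⟨(y.1 + (1 / 2 : ℝ) • K z, y.2 + (1 / 2 : ℝ) • K z), by simp only [hz']; simp⟩

/-- The defect of the coupled mode system in the slow variable, for the unknowns
`x = (a, b)` with `A(Z) = μ a(μ Z)` and `B(Z) = -μ b(μ Z)`. The mode equations are solved for
their linear parts, `P` and `Q` being the resulting cubic right-hand sides and `γ = Γ / 3`. -/
noncomputable def slowDefect (P Q : E × E → E) (γ μ : ℝ) (x : E × E) : E × E :=
  (x.1 - γ • (Real.sqrt (1 - μ ^ 2) • P x + P x.swap + μ • Q x),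
    x.2 - γ • (Real.sqrt (1 - μ ^ 2) • P x.swap + P x - μ • Q x.swap))

lemma slowDefect_zero (P Q : E × E → E) (γ : ℝ) (x : E × E) :
    slowDefect P Q γ 0 x = (x.1 - γ • (P x + P x.swap), x.2 - γ • (P x.swap + P x)) := by
  simp [slowDefect]

lemma contDiffAt_slowDefect {P Q : E × E → E} (hP : ContDiff ℝ 1 P) (hQ : ContDiff ℝ 1 Q)
    (γ : ℝ) (x : E × E) :
    ContDiffAt ℝ 1 (fun y : ℝ × (E × E) => slowDefect P Q γ y.1 y.2) (0, x) := by
  have hsqrt : ContDiffAt ℝ 1 (fun y : ℝ × (E × E) => Real.sqrt (1 - y.1 ^ 2)) (0, x) :=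
    ContDiffAt.sqrt (by fun_prop) (by simp)
  unfold slowDefect Prod.swap
  fun_prop

lemma hasFDerivAt_slowDefect_zero {P Q : E × E → E} {γ : ℝ} {w : E} {K : E →L[ℝ] E}
    (hP : DifferentiableAt ℝ P (w, w))
    (hK : HasFDerivAt (fun u => (2 * γ) • P (u, u)) K w) :
    HasFDerivAt (slowDefect P Q γ 0)
      ((ContinuousLinearMap.fst ℝ E E - (1 / 2 : ℝ) • K ∘L (.fst ℝ E E + .snd ℝ E E)).prod
        (ContinuousLinearMap.snd ℝ E E - (1 / 2 : ℝ) • K ∘L (.fst ℝ E E + .snd ℝ E E)))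
      (w, w) := by
  set D := fderiv ℝ P (w, w)
  have hD : HasFDerivAt P D (w, w) := hP.hasFDerivAt
  have hswap : HasFDerivAt (fun x : E × E => P x.swap)
      (D ∘L (ContinuousLinearMap.snd ℝ E E).prod (.fst ℝ E E)) (w, w) :=
    HasFDerivAt.comp (g := P) (w, w) hD (hasFDerivAt_snd.prodMk hasFDerivAt_fst)
  have hdiag : K = (2 * γ) • D ∘L (ContinuousLinearMap.id ℝ E).prod (.id ℝ E) :=
    hK.unique ((HasFDerivAt.comp (g := P) (f := fun u => (u, u)) w hD
      ((hasFDerivAt_id w).prodMk (hasFDerivAt_id w))).const_smul (2 * γ))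
  have hsplit : ∀ h k : E, (1 / 2 : ℝ) • K (h + k) = γ • (D (h, k) + D (k, h)) := by
    intro h k
    have hadd : D (h + k, h + k) = D (h, k) + D (k, h) := by
      rw [← map_add, Prod.mk_add_mk, add_comm k h]
    simp only [hdiag, smul_apply, ContinuousLinearMap.comp_apply, ContinuousLinearMap.prod_apply,
      ContinuousLinearMap.id_apply, hadd, smul_smul]
    ring_nf
  rw [show slowDefect P Q γ 0 = _ from funext (slowDefect_zero P Q γ)]
  refine ((hasFDerivAt_fst.sub ((hD.add hswap).const_smul γ)).prodMk
    (hasFDerivAt_snd.sub ((hswap.add hD).const_smul γ))).congr_fderiv ?_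
  refine ContinuousLinearMap.ext fun h => Prod.ext ?_ ?_
  · simpa [smul_add] using (hsplit h.1 h.2).symm
  · simpa [smul_add, add_comm] using (hsplit h.1 h.2).symm

theorem exists_branch [CompleteSpace E] {P Q : E × E → E} (hP : ContDiff ℝ 1 P)
    (hQ : ContDiff ℝ 1 Q) {γ : ℝ} {w : E} (hw : w = (2 * γ) • P (w, w)) {K : E →L[ℝ] E}
    (hK : HasFDerivAt (fun u => (2 * γ) • P (u, u)) K w)
    (hbij : Function.Bijective fun h => h - K h) :
    ∃ C : ℝ, 0 < C ∧ ∃ μ₀ : ℝ, 0 < μ₀ ∧ ∀ μ : ℝ, |μ| < μ₀ →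
      ∃! x : E × E, slowDefect P Q γ μ x = 0 ∧ ‖x.1 - w‖ + ‖x.2 - w‖ ≤ C * |μ| := by
  have hzero : slowDefect P Q γ 0 (w, w) = 0 := by
    have : γ • (P (w, w) + P (w, w)) = w := by
      conv_rhs => rw [hw]
      module
    simp [slowDefect_zero, this]
  obtain ⟨C, hC, H⟩ := exists_unique_zero_near (contDiffAt_slowDefect hP hQ γ (w, w)) hzero
    (hasFDerivAt_slowDefect_zero (hP.differentiable one_ne_zero _) hK)
    (bijective_prod_sub_half hbij)
  obtain ⟨r, hr, H⟩ := H (2 * C)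
  refine ⟨2 * C, by positivity, r, hr, fun μ hμ => ?_⟩
  obtain ⟨x, hx, hxC, huniq⟩ := H μ (by simpa using hμ)
  simp only [sub_zero, Real.norm_eq_abs] at hxC huniq
  refine ⟨x, ⟨hx, ?_⟩, fun y ⟨hy, hyC⟩ => huniq y hy ?_⟩
  · linarith [norm_fst_le (x - (w, w)), norm_snd_le (x - (w, w)),
      show ‖(x - (w, w)).1‖ = ‖x.1 - w‖ from rfl, show ‖(x - (w, w)).2‖ = ‖x.2 - w‖ from rfl]
  · exact (max_le_add_of_nonneg (norm_nonneg (y.1 - w)) (norm_nonneg (y.2 - w))).trans hyC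

end Branch

/-! ### Inverse Fourier transforms of integrable densities -/

section FourierInv

variable {V : Type*} [NormedAddCommGroup V] [InnerProductSpace ℝ V] [FiniteDimensional ℝ V]
  [MeasurableSpace V] [BorelSpace V]

lemma integrable_schwartz_mul (ψ : 𝓢(V, ℂ)) {ρ : V → ℂ} (hρ : Integrable ρ) :
    Integrable (fun x => ψ x * ρ x) := by
  obtain ⟨C, hC⟩ := ψ.decay 0 0
  exact hρ.bdd_mul (c := C) ψ.continuous.aestronglyMeasurable
    (.of_forall fun x => by simpa using hC.2 x)

lemma integrable_schwartz_mul_of_linear_growth (ψ : 𝓢(V, ℂ)) {f : V → ℂ} (hf : Continuous f)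
    {a b : ℝ} (hab : ∀ x, ‖f x‖ ≤ a + b * ‖x‖) : Integrable (fun x => ψ x * f x) := by
  refine (((ψ.integrable_pow_mul volume 0).const_mul a).add
    ((ψ.integrable_pow_mul volume 1).const_mul b)).mono'
    (ψ.continuous.mul hf).aestronglyMeasurable (.of_forall fun x => ?_)
  calc ‖ψ x * f x‖ ≤ ‖ψ x‖ * (a + b * ‖x‖) := by rw [norm_mul]; gcongr; exact hab x
    _ = a * (‖x‖ ^ 0 * ‖ψ x‖) + b * (‖x‖ ^ 1 * ‖ψ x‖) := by ring

lemma locallyIntegrable_of_integrable_schwartz_mul {f : V → ℂ}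
    (hf : ∀ ψ : 𝓢(V, ℂ), Integrable (fun x => ψ x * f x)) : LocallyIntegrable f := by
  intro x
  obtain ⟨b⟩ : Nonempty (ContDiffBump x) := inferInstance
  have hsupp : HasCompactSupport (Complex.ofRealCLM ∘ b) := b.hasCompactSupport.comp_left rfl
  have hsmooth : ContDiff ℝ (⊤ : ℕ∞) (Complex.ofRealCLM ∘ b) :=
    Complex.ofRealCLM.contDiff.comp b.contDiff
  refine ⟨Metric.closedBall x b.rIn, Metric.closedBall_mem_nhds _ b.rIn_pos, ?_⟩
  refine (hf (hsupp.toSchwartzMap hsmooth)).integrableOn.congr_fun (fun y hy => ?_)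
    measurableSet_closedBall
  simp [b.one_of_mem_closedBall hy]

lemma ae_eq_zero_of_integral_schwartz_mul_eq_zero {f : V → ℂ}
    (hf : ∀ ψ : 𝓢(V, ℂ), Integrable (fun x => ψ x * f x))
    (h₀ : ∀ ψ : 𝓢(V, ℂ), ∫ x, ψ x * f x = 0) : f =ᵐ[volume] 0 := by
  refine ae_eq_zero_of_integral_contDiff_smul_eq_zero
    (locallyIntegrable_of_integrable_schwartz_mul hf) fun g g_smooth g_supp => ?_
  have hsupp : HasCompactSupport (Complex.ofRealCLM ∘ g) := g_supp.comp_left rfl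
  have hsmooth : ContDiff ℝ (⊤ : ℕ∞) (Complex.ofRealCLM ∘ g) :=
    Complex.ofRealCLM.contDiff.comp g_smooth
  simpa using! h₀ (hsupp.toSchwartzMap hsmooth)

lemma ae_eq_of_integral_schwartz_mul_eq {f g : V → ℂ}
    (hf : ∀ ψ : 𝓢(V, ℂ), Integrable (fun x => ψ x * f x))
    (hg : ∀ ψ : 𝓢(V, ℂ), Integrable (fun x => ψ x * g x))
    (h : ∀ ψ : 𝓢(V, ℂ), ∫ x, ψ x * f x = ∫ x, ψ x * g x) : f =ᵐ[volume] g := by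
  have hsub : (fun x => f x - g x) =ᵐ[volume] 0 :=
    ae_eq_zero_of_integral_schwartz_mul_eq_zero
      (fun ψ => by simpa only [mul_sub] using! (hf ψ).sub (hg ψ))
      (fun ψ => by simp only [mul_sub]; rw [integral_sub (hf ψ) (hg ψ), h, sub_self])
  filter_upwards [hsub] with x hx using sub_eq_zero.1 hx

lemma norm_fourierInv_le (ρ : V → ℂ) (x : V) : ‖𝓕⁻ ρ x‖ ≤ ∫ η, ‖ρ η‖ := by
  rw [Real.fourierInv_eq]
  exact (norm_integral_le_integral_norm _).trans_eq (by simp)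

lemma conj_fourierInv (ρ : V → ℂ) (x : V) :
    conj (𝓕⁻ ρ x) = 𝓕⁻ (fun η => conj (ρ η)) (-x) := by
  rw [Real.fourierInv_eq, Real.fourierInv_eq, ← integral_conj]
  refine integral_congr_ae (.of_forall fun η => ?_)
  simp [Circle.smul_def, AddChar.map_neg_eq_inv]

lemma continuous_fourierInv {ρ : V → ℂ} (hρ : Integrable ρ) : Continuous (𝓕⁻ ρ) := by
  rw [Real.fourierInv_eq_fourier_comp_neg]
  exact VectorFourier.fourierIntegral_continuous Real.continuous_fourierChar
    continuous_inner hρ.comp_neg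

lemma tendsto_fourierInv_cocompact (ρ : V → ℂ) :
    Filter.Tendsto (𝓕⁻ ρ) (Filter.cocompact V) (nhds 0) := by
  rw [Real.fourierInv_eq_fourier_comp_neg]
  exact tendsto_integral_exp_inner_smul_cocompact _

lemma integrable_schwartz_mul_fourierInv (ψ : 𝓢(V, ℂ)) {ρ : V → ℂ} (hρ : Integrable ρ) :
    Integrable (fun x => ψ x * 𝓕⁻ ρ x) :=
  ψ.integrable.mul_bdd (continuous_fourierInv hρ).aestronglyMeasurable
    (.of_forall (norm_fourierInv_le ρ))

lemma schwartz_fourierInv_apply (ψ : 𝓢(V, ℂ)) (x : V) : 𝓕⁻ ψ x = 𝓕 (ψ : V → ℂ) (-x) := by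
  rw [SchwartzMap.fourierInv_coe, Real.fourierInv_eq_fourier_neg]

lemma integral_schwartz_mul_fourierInv (ψ : 𝓢(V, ℂ)) {ρ : V → ℂ} (hρ : Integrable ρ) :
    ∫ x, ψ x * 𝓕⁻ ρ x = ∫ η, 𝓕⁻ ψ η * ρ η := by
  have hflip : ∫ ξ, 𝓕 (ψ : V → ℂ) ξ * ρ (-ξ) = ∫ x, ψ x * 𝓕 (fun y => ρ (-y)) x := by
    simpa using! VectorFourier.integral_fourierIntegral_smul_eq_flip (L := innerₗ V)
      (μ := volume) (ν := volume) (f := fun x => ψ x) (g := fun x => ρ (-x))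
      Real.continuous_fourierChar continuous_inner ψ.integrable hρ.comp_neg
  rw [Real.fourierInv_eq_fourier_comp_neg, ← hflip,
    ← integral_neg_eq_self (fun η => 𝓕⁻ ψ η * ρ η)]
  simp only [schwartz_fourierInv_apply, neg_neg]

lemma integral_fourier_schwartz_mul_fourierInv (ψ : 𝓢(V, ℂ)) {ρ : V → ℂ} (hρ : Integrable ρ) :
    ∫ x, 𝓕 ψ x * 𝓕⁻ ρ x = ∫ η, ψ η * ρ η := by
  simp [integral_schwartz_mul_fourierInv _ hρ]

lemma ae_eq_of_fourierInv_eq {ρ σ : V → ℂ} (hρ : Integrable ρ) (hσ : Integrable σ)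
    (h : ∀ x, 𝓕⁻ ρ x = 𝓕⁻ σ x) : ρ =ᵐ[volume] σ :=
  ae_eq_of_integral_schwartz_mul_eq (fun ψ => integrable_schwartz_mul ψ hρ)
    (fun ψ => integrable_schwartz_mul ψ hσ) fun ψ => by
      rw [← integral_fourier_schwartz_mul_fourierInv ψ hρ,
        ← integral_fourier_schwartz_mul_fourierInv ψ hσ]
      simp only [h]

end FourierInv

lemma Represents.ae_eq {T : 𝓢'(ℝ, ℂ)} {f g : ℝ → ℂ} (hf : Represents T f)
    (hg : Represents T g) : f =ᵐ[volume] g :=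
  ae_eq_of_integral_schwartz_mul_eq (fun ψ => (hf ψ).1) (fun ψ => (hg ψ).1)
    (fun ψ => by rw [← (hf ψ).2, ← (hg ψ).2])

/-! ### Differentiation as multiplication by the frequency -/

lemma hasDerivAt_fourierInv {ρ : ℝ → ℂ} (hρ : Integrable ρ)
    (hρ' : Integrable (fun η : ℝ => (η : ℂ) * ρ η)) (x : ℝ) :
    HasDerivAt (𝓕⁻ ρ) (𝓕⁻ (fun η : ℝ => 2 * Real.pi * Complex.I * η * ρ η) x) x := by
  rw [Real.fourierInv_eq_fourier_comp_neg, Real.fourierInv_eq_fourier_comp_neg]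
  convert! Real.hasDerivAt_fourier (f := fun η => ρ (-η)) hρ.comp_neg
    (by simpa using! hρ'.comp_neg.neg) x using 3
  simp

lemma fourierInv_derivCLM (ψ : 𝓢(ℝ, ℂ)) (η : ℝ) :
    𝓕⁻ (SchwartzMap.derivCLM ℂ ℂ ψ) η = -(2 * Real.pi * Complex.I * η) * 𝓕⁻ ψ η := by
  have hcoe : (SchwartzMap.derivCLM ℂ ℂ ψ : ℝ → ℂ) = deriv ψ := by
    ext x; simp
  rw [schwartz_fourierInv_apply, schwartz_fourierInv_apply, hcoe,
    Real.fourier_deriv ψ.integrable ψ.differentiable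
      (by simpa using! (SchwartzMap.derivCLM ℂ ℂ ψ).integrable)]
  simp

lemma fourierInv_derivCLM_derivCLM (ψ : 𝓢(ℝ, ℂ)) (η : ℝ) :
    𝓕⁻ (SchwartzMap.derivCLM ℂ ℂ (SchwartzMap.derivCLM ℂ ℂ ψ)) η
      = -(2 * Real.pi * η) ^ 2 * 𝓕⁻ ψ η := by
  rw [fourierInv_derivCLM, fourierInv_derivCLM]
  linear_combination (2 * Real.pi * η) ^ 2 * 𝓕⁻ ψ η * Complex.I_sq

lemma iteratedDeriv_two_schwartz (ψ : 𝓢(ℝ, ℂ)) :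
    iteratedDeriv 2 ψ = SchwartzMap.derivCLM ℂ ℂ (SchwartzMap.derivCLM ℂ ℂ ψ) := by
  have hderiv (χ : 𝓢(ℝ, ℂ)) : deriv χ = (SchwartzMap.derivCLM ℂ ℂ χ : ℝ → ℂ) := by
    ext x; simp
  rw [iteratedDeriv_succ, iteratedDeriv_one, hderiv, hderiv]

lemma integral_schwartz_mul_deriv (χ : 𝓢(ℝ, ℂ)) {f f' : ℝ → ℂ}
    (hf : ∀ x, HasDerivAt f (f' x) x) (hχf' : Integrable fun x => χ x * f' x)
    (hχ'f : Integrable fun x => SchwartzMap.derivCLM ℂ ℂ χ x * f x)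
    (hχf : Integrable fun x => χ x * f x) :
    ∫ x, χ x * f' x = -∫ x, SchwartzMap.derivCLM ℂ ℂ χ x * f x :=
  integral_mul_deriv_eq_deriv_mul_of_integrable
    (fun x _ => by simpa using! χ.differentiable.differentiableAt.hasDerivAt)
    (fun x _ => hf x) hχf' hχ'f hχf

lemma norm_le_add_mul_of_norm_deriv_le {f f' : ℝ → ℂ} {M : ℝ}
    (hf : ∀ x, HasDerivAt f (f' x) x) (hM : ∀ x, ‖f' x‖ ≤ M) (x : ℝ) :
    ‖f x‖ ≤ ‖f 0‖ + M * ‖x‖ := by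
  have hmvt : ‖f x - f 0‖ ≤ M * ‖x - 0‖ :=
    convex_univ.norm_image_sub_le_of_norm_hasDerivWithin_le
      (fun y _ => (hf y).hasDerivWithinAt) (fun y _ => hM y) (Set.mem_univ _) (Set.mem_univ _)
  rw [sub_zero] at hmvt
  linarith [norm_le_norm_add_norm_sub' (f x) (f 0)]

lemma integral_schwartz_mul_iteratedDeriv_two (χ : 𝓢(ℝ, ℂ)) {f : ℝ → ℂ} {M N : ℝ}
    (hf : ContDiff ℝ 2 f) (hM : ∀ x, ‖f x‖ ≤ M) (hN : ∀ x, ‖iteratedDeriv 2 f x‖ ≤ N) :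
    ∫ x, χ x * iteratedDeriv 2 f x
      = ∫ x, SchwartzMap.derivCLM ℂ ℂ (SchwartzMap.derivCLM ℂ ℂ χ) x * f x := by
  have hf' : ContDiff ℝ 1 (deriv f) := hf.deriv' (n := 1)
  have hderiv : ∀ x, HasDerivAt f (deriv f x) x := fun x =>
    (hf.differentiable two_ne_zero x).hasDerivAt
  have hderiv₂ : ∀ x, HasDerivAt (deriv f) (iteratedDeriv 2 f x) x := fun x => by
    rw [iteratedDeriv_succ, iteratedDeriv_one]
    exact (hf'.differentiable one_ne_zero x).hasDerivAt
  have hint₀ (ψ : 𝓢(ℝ, ℂ)) : Integrable fun x => ψ x * f x :=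
    integrable_schwartz_mul_of_linear_growth ψ hf.continuous (b := 0) (by simpa using hM)
  have hint₁ (ψ : 𝓢(ℝ, ℂ)) : Integrable fun x => ψ x * deriv f x :=
    integrable_schwartz_mul_of_linear_growth ψ hf'.continuous
      (norm_le_add_mul_of_norm_deriv_le hderiv₂ hN)
  have hint₂ : Integrable fun x => χ x * iteratedDeriv 2 f x :=
    integrable_schwartz_mul_of_linear_growth χ (hf.continuous_iteratedDeriv 2 le_rfl) (b := 0)
      (by simpa using hN)
  rw [integral_schwartz_mul_deriv χ hderiv₂ hint₂ (hint₁ _) (hint₁ _),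
    integral_schwartz_mul_deriv _ hderiv (hint₁ _) (hint₀ _) (hint₀ _), neg_neg]

lemma integrable_schwartz_mul_id_mul (ψ : 𝓢(ℝ, ℂ)) {ρ : ℝ → ℂ} (hρ : Integrable ρ) :
    Integrable (fun η : ℝ => ψ η * (2 * Real.pi * Complex.I * η * ρ η)) := by
  refine (integrable_schwartz_mul (-(𝓕⁻ (SchwartzMap.derivCLM ℂ ℂ (𝓕 ψ)))) hρ).congr
    (.of_forall fun η => ?_)
  simp only [neg_apply, fourierInv_derivCLM, FourierTransform.fourierInv_fourier_eq]
  ring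

lemma integrable_schwartz_mul_sq_mul (ψ : 𝓢(ℝ, ℂ)) {ρ : ℝ → ℂ} (hρ : Integrable ρ) :
    Integrable (fun η : ℝ => ψ η * (-(2 * Real.pi * η) ^ 2 * ρ η)) := by
  refine (integrable_schwartz_mul
    (𝓕⁻ (SchwartzMap.derivCLM ℂ ℂ (SchwartzMap.derivCLM ℂ ℂ (𝓕 ψ)))) hρ).congr
    (.of_forall fun η => ?_)
  simp only [fourierInv_derivCLM_derivCLM, FourierTransform.fourierInv_fourier_eq]
  ring

lemma ae_eq_of_hasDerivAt_fourierInv {ρ σ : ℝ → ℂ} (hρ : Integrable ρ) (hσ : Integrable σ)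
    (h : ∀ x, HasDerivAt (𝓕⁻ ρ) (𝓕⁻ σ x) x) :
    (fun η : ℝ => 2 * Real.pi * Complex.I * η * ρ η) =ᵐ[volume] σ := by
  refine ae_eq_of_integral_schwartz_mul_eq (integrable_schwartz_mul_id_mul · hρ)
    (integrable_schwartz_mul · hσ) fun ψ => ?_
  rw [← integral_fourier_schwartz_mul_fourierInv ψ hσ,
    integral_schwartz_mul_deriv (𝓕 ψ) h (integrable_schwartz_mul_fourierInv _ hσ)
      (integrable_schwartz_mul_fourierInv _ hρ) (integrable_schwartz_mul_fourierInv _ hρ),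
    integral_schwartz_mul_fourierInv _ hρ, ← integral_neg]
  refine integral_congr_ae (.of_forall fun η => ?_)
  simp only [fourierInv_derivCLM, FourierTransform.fourierInv_fourier_eq]
  ring

lemma ae_eq_of_iteratedDeriv_two_fourierInv {ρ σ : ℝ → ℂ} (hρ : Integrable ρ)
    (hσ : Integrable σ) (hC : ContDiff ℝ 2 (𝓕⁻ ρ))
    (h : ∀ x, iteratedDeriv 2 (𝓕⁻ ρ) x = 𝓕⁻ σ x) :
    (fun η : ℝ => -(2 * Real.pi * η) ^ 2 * ρ η) =ᵐ[volume] σ := by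
  refine ae_eq_of_integral_schwartz_mul_eq (integrable_schwartz_mul_sq_mul · hρ)
    (integrable_schwartz_mul · hσ) fun ψ => ?_
  rw [← integral_fourier_schwartz_mul_fourierInv ψ hσ]
  simp only [← h]
  rw [integral_schwartz_mul_iteratedDeriv_two _ hC (norm_fourierInv_le ρ)
    (fun x => h x ▸ norm_fourierInv_le σ x), integral_schwartz_mul_fourierInv _ hρ]
  refine integral_congr_ae (.of_forall fun η => ?_)
  simp only [fourierInv_derivCLM_derivCLM, FourierTransform.fourierInv_fourier_eq]
  ring

/-! ### Weighted `L²` convolution algebras -/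

lemma sq_rpow_half (c : ℝ≥0∞) : (c ^ 2) ^ (1 / 2 : ℝ) = c := by
  rw [← ENNReal.rpow_natCast, ← ENNReal.rpow_mul]; norm_num

section WeightedCauchySchwarz

variable {α : Type*} [MeasurableSpace α] {μ : Measure α} {w : α → ℝ≥0∞}

lemma sq_lintegral_le_lintegral_inv_mul (hw : AEMeasurable w μ) (h0 : ∀ a, w a ≠ 0)
    (htop : ∀ a, w a ≠ ∞) {f : α → ℝ≥0∞} (hf : AEMeasurable f μ) :
    (∫⁻ a, f a ∂μ) ^ 2 ≤ (∫⁻ a, (w a)⁻¹ ∂μ) * ∫⁻ a, w a * f a ^ 2 ∂μ := by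
  have sq_half (c : ℝ≥0∞) : (c ^ (1 / 2 : ℝ)) ^ 2 = c := by
    rw [← ENNReal.rpow_natCast, ← ENNReal.rpow_mul]; norm_num
  have hfactor (a : α) : ((w a)⁻¹) ^ (1 / 2 : ℝ) * (w a * f a ^ 2) ^ (1 / 2 : ℝ) = f a := by
    rw [← ENNReal.mul_rpow_of_nonneg _ _ (by norm_num), ← mul_assoc,
      ENNReal.inv_mul_cancel (h0 a) (htop a), one_mul, sq_rpow_half]
  have h := ENNReal.lintegral_mul_norm_pow_le hw.inv (hw.mul (hf.pow_const 2))
    (p := 1 / 2) (q := 1 / 2) (by norm_num) (by norm_num) (by norm_num)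
  simp only [Pi.inv_apply, Pi.mul_apply, hfactor] at h
  calc _ ≤ ((∫⁻ a, (w a)⁻¹ ∂μ) ^ (1 / 2 : ℝ) * (∫⁻ a, w a * f a ^ 2 ∂μ) ^ (1 / 2 : ℝ)) ^ 2 := by
        gcongr
    _ = _ := by rw [mul_pow, sq_half, sq_half]

lemma ae_withDensity_eq (hw : Measurable w) (h0 : ∀ a, w a ≠ 0) : ae (μ.withDensity w) = ae μ :=
  le_antisymm (withDensity_absolutelyContinuous μ w).ae_le
    (withDensity_absolutelyContinuous' hw.aemeasurable (ae_of_all _ h0)).ae_le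

lemma aestronglyMeasurable_of_withDensity {β : Type*} [TopologicalSpace β] (hw : Measurable w)
    (h0 : ∀ a, w a ≠ 0) {f : α → β} (hf : AEStronglyMeasurable f (μ.withDensity w)) :
    AEStronglyMeasurable f μ :=
  hf.mono_ac (withDensity_absolutelyContinuous' hw.aemeasurable (ae_of_all _ h0))

lemma eLpNorm_two_withDensity_sq {β : Type*} [NormedAddCommGroup β] (hw : Measurable w)
    {f : α → β} (hf : AEStronglyMeasurable f μ) :
    eLpNorm f 2 (μ.withDensity w) ^ 2 = ∫⁻ a, w a * ‖f a‖ₑ ^ 2 ∂μ := by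
  have h := eLpNorm_nnreal_pow_eq_lintegral (f := f) (μ := μ.withDensity w) (p := 2) two_ne_zero
  simp only [NNReal.coe_ofNat, ENNReal.coe_ofNat, ENNReal.rpow_ofNat] at h
  rw [h, lintegral_withDensity_eq_lintegral_mul₀ hw.aemeasurable (hf.enorm.pow_const 2)]
  rfl

lemma integrable_of_memLp_withDensity {β : Type*} [NormedAddCommGroup β] (hw : Measurable w)
    (h0 : ∀ a, w a ≠ 0) (htop : ∀ a, w a ≠ ∞) (hinv : ∫⁻ a, (w a)⁻¹ ∂μ ≠ ∞) {f : α → β}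
    (hf : MemLp f 2 (μ.withDensity w)) : Integrable f μ := by
  have hfm := aestronglyMeasurable_of_withDensity hw h0 hf.1
  refine ⟨hfm, ?_⟩
  have h := sq_lintegral_le_lintegral_inv_mul hw.aemeasurable h0 htop hfm.enorm
  rw [← eLpNorm_two_withDensity_sq hw hfm] at h
  have := h.trans_lt (ENNReal.mul_lt_top hinv.lt_top (ENNReal.pow_lt_top hf.2))
  exact lt_of_not_ge fun hge => by simp [top_le_iff.1 hge] at this

end WeightedCauchySchwarz

section ConvolutionWeight

variable {G : Type*} [AddCommGroup G] [MeasurableSpace G]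

/-- Weights for which `L²(w dμ)` is an algebra under convolution: `w` satisfies a triangle
inequality up to the factor `C`, and `1 / w` is integrable. -/
structure IsConvolutionWeight (μ : Measure G) (w : G → ℝ≥0∞) (C : NNReal) : Prop where
  measurable : Measurable w
  ne_zero : ∀ a, w a ≠ 0
  ne_top : ∀ a, w a ≠ ∞
  add_le : ∀ a b, w (a + b) ≤ C * (w a + w b)
  lintegral_inv_ne_top : ∫⁻ a, (w a)⁻¹ ∂μ ≠ ∞

section Convolution

variable {μ : Measure G} {f g : G → ℝ}

lemma enorm_convolution_le (k : G) :
    ‖(f ⋆[ContinuousLinearMap.mul ℝ ℝ, μ] g) k‖ₑ ≤ ∫⁻ a, ‖f a‖ₑ * ‖g (k - a)‖ₑ ∂μ := by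
  refine (enorm_integral_le_lintegral_enorm _).trans_eq (lintegral_congr fun a => ?_)
  exact enorm_mul _ _

lemma stronglyMeasurable_convolution [MeasurableAdd₂ G] [MeasurableNeg G] [SFinite μ]
    (hf : StronglyMeasurable f) (hg : StronglyMeasurable g) :
    StronglyMeasurable (f ⋆[ContinuousLinearMap.mul ℝ ℝ, μ] g) :=
  StronglyMeasurable.integral_prod_right' (f := fun p : G × G => f p.2 * g (p.1 - p.2))
    ((hf.comp_measurable measurable_snd).mul (hg.comp_measurable measurable_sub))

end Convolution

namespace IsConvolutionWeight

variable {μ : Measure G} {w : G → ℝ≥0∞} {C : NNReal}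

lemma mul_inv_mul_inv_le (hw : IsConvolutionWeight μ w C) (a b : G) :
    w (a + b) * (w a * w b)⁻¹ ≤ C * ((w a)⁻¹ + (w b)⁻¹) := by
  have ha := ENNReal.mul_inv_cancel (hw.ne_zero a) (hw.ne_top a)
  have hb := ENNReal.mul_inv_cancel (hw.ne_zero b) (hw.ne_top b)
  rw [ENNReal.mul_inv (.inl (hw.ne_zero a)) (.inl (hw.ne_top a))]
  calc w (a + b) * ((w a)⁻¹ * (w b)⁻¹)
      ≤ C * (w a + w b) * ((w a)⁻¹ * (w b)⁻¹) := by gcongr; exact hw.add_le a b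
    _ = C * (w a * (w a)⁻¹ * (w b)⁻¹ + w b * (w b)⁻¹ * (w a)⁻¹) := by ring
    _ = _ := by rw [ha, hb, one_mul, one_mul, add_comm]

lemma integrable (hw : IsConvolutionWeight μ w C) {β : Type*} [NormedAddCommGroup β] {f : G → β}
    (hf : MemLp f 2 (μ.withDensity w)) : Integrable f μ :=
  integrable_of_memLp_withDensity hw.measurable hw.ne_zero hw.ne_top hw.lintegral_inv_ne_top hf

lemma integrable_coeFn (hw : IsConvolutionWeight μ w C) (f : Lp ℝ 2 (μ.withDensity w)) :
    Integrable f μ :=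
  hw.integrable (Lp.memLp f)

lemma ae_eq_withDensity_iff (hw : IsConvolutionWeight μ w C) {β : Type*} {f g : G → β} :
    f =ᵐ[μ.withDensity w] g ↔ f =ᵐ[μ] g := by
  rw [Filter.EventuallyEq, ae_withDensity_eq hw.measurable hw.ne_zero]; rfl

variable [MeasurableAdd₂ G] [MeasurableNeg G] [μ.IsAddLeftInvariant]

lemma ae_convolutionExistsAt [SFinite μ] (hw : IsConvolutionWeight μ w C)
    (f g : Lp ℝ 2 (μ.withDensity w)) :
    ∀ᵐ k ∂μ, ConvolutionExistsAt f g k (ContinuousLinearMap.mul ℝ ℝ) μ :=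
  (hw.integrable_coeFn f).ae_convolution_exists _ (hw.integrable_coeFn g)

variable [μ.IsNegInvariant]

lemma mul_lintegral_inv_le (hw : IsConvolutionWeight μ w C) (k : G) :
    w k * ∫⁻ a, (w a * w (k - a))⁻¹ ∂μ ≤ 2 * C * ∫⁻ a, (w a)⁻¹ ∂μ := by
  have hm := hw.measurable
  calc w k * ∫⁻ a, (w a * w (k - a))⁻¹ ∂μ
      = ∫⁻ a, w k * (w a * w (k - a))⁻¹ ∂μ := (lintegral_const_mul _ (by fun_prop)).symm
    _ ≤ ∫⁻ a, C * ((w a)⁻¹ + (w (k - a))⁻¹) ∂μ := by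
        refine lintegral_mono fun a => ?_
        simpa only [add_sub_cancel] using hw.mul_inv_mul_inv_le a (k - a)
    _ = 2 * C * ∫⁻ a, (w a)⁻¹ ∂μ := by
        rw [lintegral_const_mul _ (by fun_prop), lintegral_add_left (by fun_prop),
          lintegral_sub_left_eq_self fun a => (w a)⁻¹]
        ring

variable [SFinite μ]

lemma lintegral_mul_sq_convolution_le (hw : IsConvolutionWeight μ w C) {f g : G → ℝ≥0∞}
    (hf : Measurable f) (hg : Measurable g) :
    ∫⁻ k, w k * (∫⁻ a, f a * g (k - a) ∂μ) ^ 2 ∂μ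
      ≤ 2 * C * (∫⁻ a, (w a)⁻¹ ∂μ) * ((∫⁻ a, w a * f a ^ 2 ∂μ) * ∫⁻ a, w a * g a ^ 2 ∂μ) := by
  have hm := hw.measurable
  set M := 2 * C * ∫⁻ a, (w a)⁻¹ ∂μ
  have hpointwise (k : G) : w k * (∫⁻ a, f a * g (k - a) ∂μ) ^ 2
      ≤ M * ∫⁻ a, (w a * f a ^ 2) * (w (k - a) * g (k - a) ^ 2) ∂μ := by
    have h := sq_lintegral_le_lintegral_inv_mul (μ := μ) (w := fun a => w a * w (k - a))
      (by fun_prop) (fun a => mul_ne_zero (hw.ne_zero _) (hw.ne_zero _))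
      (fun a => ENNReal.mul_ne_top (hw.ne_top _) (hw.ne_top _))
      (f := fun a => f a * g (k - a)) (by fun_prop)
    refine (mul_le_mul_right h _).trans ?_
    rw [← mul_assoc]
    refine mul_le_mul' (hw.mul_lintegral_inv_le k) (le_of_eq (lintegral_congr fun a => ?_))
    ring
  calc _ ≤ ∫⁻ k, M * ∫⁻ a, (w a * f a ^ 2) * (w (k - a) * g (k - a) ^ 2) ∂μ ∂μ :=
        lintegral_mono hpointwise
    _ = M * ∫⁻ a, ∫⁻ k, (w a * f a ^ 2) * (w (k - a) * g (k - a) ^ 2) ∂μ ∂μ := by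
        rw [lintegral_const_mul _ (by fun_prop), lintegral_lintegral_swap (by fun_prop)]
    _ = M * ∫⁻ a, (w a * f a ^ 2) * ∫⁻ k, w k * g k ^ 2 ∂μ ∂μ := by
        congr 1
        refine lintegral_congr fun a => ?_
        rw [lintegral_const_mul _ (by fun_prop),
          lintegral_sub_right_eq_self (fun k => w k * g k ^ 2) a]
    _ = _ := by rw [lintegral_mul_const _ (by fun_prop)]

lemma eLpNorm_convolution_le (hw : IsConvolutionWeight μ w C) {f g : G → ℝ}
    (hf : StronglyMeasurable f) (hg : StronglyMeasurable g) :
    eLpNorm (f ⋆[ContinuousLinearMap.mul ℝ ℝ, μ] g) 2 (μ.withDensity w)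
      ≤ (2 * C * ∫⁻ a, (w a)⁻¹ ∂μ) ^ (1 / 2 : ℝ) * (eLpNorm f 2 (μ.withDensity w)
        * eLpNorm g 2 (μ.withDensity w)) := by
  have hsq : eLpNorm (f ⋆[ContinuousLinearMap.mul ℝ ℝ, μ] g) 2 (μ.withDensity w) ^ 2
      ≤ (2 * C * ∫⁻ a, (w a)⁻¹ ∂μ) * (eLpNorm f 2 (μ.withDensity w)
        * eLpNorm g 2 (μ.withDensity w)) ^ 2 := by
    rw [mul_pow, eLpNorm_two_withDensity_sq hw.measurable hf.aestronglyMeasurable,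
      eLpNorm_two_withDensity_sq hw.measurable hg.aestronglyMeasurable,
      eLpNorm_two_withDensity_sq hw.measurable
        (stronglyMeasurable_convolution hf hg).aestronglyMeasurable]
    refine le_trans (lintegral_mono fun k => ?_) (hw.lintegral_mul_sq_convolution_le
      (f := fun a => ‖f a‖ₑ) (g := fun a => ‖g a‖ₑ) hf.enorm hg.enorm)
    gcongr
    exact enorm_convolution_le k
  simpa only [ENNReal.mul_rpow_of_nonneg _ _ (by norm_num : (0 : ℝ) ≤ 1 / 2), sq_rpow_half] using
    ENNReal.rpow_le_rpow hsq (by norm_num : (0 : ℝ) ≤ 1 / 2)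

lemma memLp_convolution (hw : IsConvolutionWeight μ w C) (f g : Lp ℝ 2 (μ.withDensity w)) :
    MemLp (f ⋆[ContinuousLinearMap.mul ℝ ℝ, μ] g) 2 (μ.withDensity w) := by
  have hf := Lp.stronglyMeasurable f
  have hg := Lp.stronglyMeasurable g
  refine ⟨(stronglyMeasurable_convolution hf hg).aestronglyMeasurable,
    (hw.eLpNorm_convolution_le hf hg).trans_lt ?_⟩
  have hK : 2 * C * ∫⁻ a, (w a)⁻¹ ∂μ ≠ ∞ :=
    ENNReal.mul_ne_top (by finiteness) hw.lintegral_inv_ne_top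
  exact ENNReal.mul_lt_top (ENNReal.rpow_lt_top_of_nonneg (by norm_num) hK)
    (ENNReal.mul_lt_top (Lp.eLpNorm_lt_top f) (Lp.eLpNorm_lt_top g))

/-- Convolution as a bounded bilinear operation on `L²(w dμ)`. -/
noncomputable def conv (hw : IsConvolutionWeight μ w C) :
    Lp ℝ 2 (μ.withDensity w) →L[ℝ] Lp ℝ 2 (μ.withDensity w) →L[ℝ] Lp ℝ 2 (μ.withDensity w) :=
  LinearMap.mkContinuous₂
    (LinearMap.mk₂ ℝ (fun f g => (hw.memLp_convolution f g).toLp)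
      (fun f₁ f₂ g => by
        rw [← MemLp.toLp_add, MemLp.toLp_eq_toLp_iff, hw.ae_eq_withDensity_iff,
          convolution_congr _ (hw.ae_eq_withDensity_iff.1 (Lp.coeFn_add f₁ f₂)) .rfl]
        filter_upwards [hw.ae_convolutionExistsAt f₁ g, hw.ae_convolutionExistsAt f₂ g]
          with k h₁ h₂ using h₁.add_distrib h₂)
      (fun c f g => by
        rw [← MemLp.toLp_const_smul, MemLp.toLp_eq_toLp_iff, hw.ae_eq_withDensity_iff,
          convolution_congr _ (hw.ae_eq_withDensity_iff.1 (Lp.coeFn_smul c f)) .rfl,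
          smul_convolution])
      (fun f g₁ g₂ => by
        rw [← MemLp.toLp_add, MemLp.toLp_eq_toLp_iff, hw.ae_eq_withDensity_iff,
          convolution_congr _ .rfl (hw.ae_eq_withDensity_iff.1 (Lp.coeFn_add g₁ g₂))]
        filter_upwards [hw.ae_convolutionExistsAt f g₁, hw.ae_convolutionExistsAt f g₂]
          with k h₁ h₂ using h₁.distrib_add h₂)
      (fun c f g => by
        rw [← MemLp.toLp_const_smul, MemLp.toLp_eq_toLp_iff, hw.ae_eq_withDensity_iff,
          convolution_congr _ .rfl (hw.ae_eq_withDensity_iff.1 (Lp.coeFn_smul c g)),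
          convolution_smul]))
    ((2 * C * ∫⁻ a, (w a)⁻¹ ∂μ) ^ (1 / 2 : ℝ)).toReal fun f g => by
      have hK : 2 * C * ∫⁻ a, (w a)⁻¹ ∂μ ≠ ∞ :=
        ENNReal.mul_ne_top (by finiteness) hw.lintegral_inv_ne_top
      have h := ENNReal.toReal_mono (by finiteness) (hw.eLpNorm_convolution_le
        (Lp.stronglyMeasurable f) (Lp.stronglyMeasurable g))
      simpa only [ENNReal.toReal_mul, ← Lp.norm_def, LinearMap.mk₂_apply, Lp.norm_toLp,
        mul_assoc] using h

lemma coeFn_conv (hw : IsConvolutionWeight μ w C) (f g : Lp ℝ 2 (μ.withDensity w)) :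
    hw.conv f g =ᵐ[μ] f ⋆[ContinuousLinearMap.mul ℝ ℝ, μ] g :=
  hw.ae_eq_withDensity_iff.1 (hw.memLp_convolution f g).coeFn_toLp

lemma conv_comm (hw : IsConvolutionWeight μ w C) (f g : Lp ℝ 2 (μ.withDensity w)) :
    hw.conv f g = hw.conv g f := by
  refine Lp.ext (hw.ae_eq_withDensity_iff.2 ?_)
  filter_upwards [hw.coeFn_conv f g, hw.coeFn_conv g f] with k h₁ h₂
  rw [h₁, h₂, convolution_eq_swap]
  simp only [convolution_def, ContinuousLinearMap.mul_apply', mul_comm]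

end IsConvolutionWeight

end ConvolutionWeight

section Multiplier

variable {α : Type*} [MeasurableSpace α] {ν : Measure α}

/-- Multiplication by a bounded function on `L²(ν)`. -/
noncomputable def multiplier {m : α → ℝ} (hm : MemLp m ∞ ν) : Lp ℝ 2 ν →L[ℝ] Lp ℝ 2 ν :=
  (ContinuousLinearMap.mul ℝ ℝ).holderL ν ∞ 2 2 hm.toLp

lemma coeFn_multiplier {m : α → ℝ} (hm : MemLp m ∞ ν) (f : Lp ℝ 2 ν) :
    multiplier hm f =ᵐ[ν] fun k => m k * f k := by
  filter_upwards [(ContinuousLinearMap.mul ℝ ℝ).coeFn_holder (r := 2) hm.toLp f, hm.coeFn_toLp]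
    with k h₁ h₂
  exact h₁.trans (by rw [h₂]; rfl)

end Multiplier

/-! ### The Sobolev weight on the frequency space `ℤ × ℝ` -/

instance isNegInvariant_prod {α β : Type*} [MeasurableSpace α] [MeasurableSpace β] [AddGroup α]
    [AddGroup β] [MeasurableNeg α] [MeasurableNeg β] (μ : Measure α) (ν : Measure β) [SFinite μ]
    [SFinite ν] [μ.IsNegInvariant] [ν.IsNegInvariant] : (μ.prod ν).IsNegInvariant where
  neg_eq_self := by
    have h := Measure.map_prod_map μ ν (f := Neg.neg) (g := Neg.neg) measurable_neg measurable_neg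
    rw [show μ.map Neg.neg = μ from Measure.neg_eq_self _,
      show ν.map Neg.neg = ν from Measure.neg_eq_self _] at h
    exact h.symm

/-- The measure on frequencies `(p, η)`: counting measure in the mode `p`, Lebesgue measure in the
variable `η = ξ / 2π` of Mathlib's Fourier transform. -/
noncomputable abbrev modeMeasure : Measure (ℤ × ℝ) := Measure.count.prod volume

/-- The squared frequency `p² + ξ²` at `ξ = 2πη`. At `p = 0`, a mode that is absent from `X^s`,
`p²` is replaced by `1` to keep negative powers integrable. -/
noncomputable def freqSq (k : ℤ × ℝ) : ℝ := max 1 ((k.1 : ℝ) ^ 2) + (2 * Real.pi * k.2) ^ 2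

/-- The weight of the squared `X^s` norm on the frequency space. -/
noncomputable def sobolevWeight (s : ℝ) (k : ℤ × ℝ) : ℝ≥0∞ := ENNReal.ofReal (freqSq k ^ s)

lemma max_one_sq_le_freqSq (k : ℤ × ℝ) : max 1 ((k.1 : ℝ) ^ 2) ≤ freqSq k :=
  le_add_of_nonneg_right (sq_nonneg _)

lemma one_add_sq_le_freqSq (k : ℤ × ℝ) : 1 + (2 * Real.pi * k.2) ^ 2 ≤ freqSq k :=
  add_le_add_left (le_max_left _ _) _

lemma freqSq_pos (k : ℤ × ℝ) : 0 < freqSq k :=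
  zero_lt_one.trans_le ((le_max_left _ _).trans (max_one_sq_le_freqSq k))

lemma freqSq_neg (k : ℤ × ℝ) : freqSq (-k) = freqSq k := by simp [freqSq]

lemma freqSq_of_odd {p : ℤ} (hp : Odd p) (η : ℝ) :
    freqSq (p, η) = (p : ℝ) ^ 2 + (2 * Real.pi * η) ^ 2 := by
  have h0 : p ≠ 0 := by rintro rfl; exact absurd hp (by decide)
  have h1 : (1 : ℝ) ≤ (p : ℝ) ^ 2 := by exact_mod_cast (by positivity : 0 < p ^ 2)
  simp [freqSq, max_eq_right h1]

lemma measurable_freqSq : Measurable freqSq := by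
  unfold freqSq
  have : Measurable fun k : ℤ × ℝ => (k.1 : ℝ) := (measurable_of_countable _).comp measurable_fst
  fun_prop

lemma freqSq_add_le (a b : ℤ × ℝ) : freqSq (a + b) ≤ 2 * (freqSq a + freqSq b) := by
  have hsq (x y : ℝ) : (x + y) ^ 2 ≤ 2 * (x ^ 2 + y ^ 2) := by nlinarith [sq_nonneg (x - y)]
  have hmax : max 1 (((a.1 : ℝ) + b.1) ^ 2)
      ≤ 2 * (max 1 ((a.1 : ℝ) ^ 2) + max 1 ((b.1 : ℝ) ^ 2)) := by
    have ha := le_max_left 1 ((a.1 : ℝ) ^ 2)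
    have ha' := le_max_right 1 ((a.1 : ℝ) ^ 2)
    have hb := le_max_left 1 ((b.1 : ℝ) ^ 2)
    have hb' := le_max_right 1 ((b.1 : ℝ) ^ 2)
    exact max_le (by linarith) (by linarith [hsq a.1 b.1])
  have h := hsq (2 * Real.pi * a.2) (2 * Real.pi * b.2)
  simp only [freqSq, Prod.fst_add, Prod.snd_add, Int.cast_add, mul_add (2 * Real.pi)]
  linarith

lemma sobolevWeight_add_le {s : ℝ} (hs : 0 ≤ s) (a b : ℤ × ℝ) :
    sobolevWeight s (a + b)
      ≤ ((4 ^ s : ℝ).toNNReal : ℝ≥0∞) * (sobolevWeight s a + sobolevWeight s b) := by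
  have hmax : freqSq (a + b) ≤ 4 * max (freqSq a) (freqSq b) := by
    have := freqSq_add_le a b
    linarith [le_max_left (freqSq a) (freqSq b), le_max_right (freqSq a) (freqSq b)]
  have h0 : 0 ≤ max (freqSq a) (freqSq b) := (freqSq_pos a).le.trans (le_max_left _ _)
  have ha := Real.rpow_nonneg (freqSq_pos a).le s
  have hb := Real.rpow_nonneg (freqSq_pos b).le s
  have hsum : max (freqSq a) (freqSq b) ^ s ≤ freqSq a ^ s + freqSq b ^ s := by
    rcases max_choice (freqSq a) (freqSq b) with h | h <;> rw [h] <;> linarith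
  rw [sobolevWeight, sobolevWeight, sobolevWeight, ← ENNReal.ofReal_add ha hb,
    ENNReal.ofNNReal_toNNReal, ← ENNReal.ofReal_mul (by positivity)]
  refine ENNReal.ofReal_le_ofReal ?_
  calc freqSq (a + b) ^ s ≤ (4 * max (freqSq a) (freqSq b)) ^ s :=
        Real.rpow_le_rpow (freqSq_pos _).le hmax hs
    _ = 4 ^ s * max (freqSq a) (freqSq b) ^ s := Real.mul_rpow (by norm_num) h0
    _ ≤ _ := by gcongr

lemma summable_max_one_sq_rpow {s : ℝ} (hs : 1 < s) :
    Summable fun n : ℤ => max 1 ((n : ℝ) ^ 2) ^ (-s / 2) := by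
  have hsum : Summable fun n : ℤ => |(n : ℝ)| ^ (-s) + if n = 0 then 1 else 0 :=
    (Real.summable_abs_int_rpow hs).add
      (summable_of_ne_finset_zero (s := {0}) (by intro b hb; simpa using hb))
  refine hsum.of_nonneg_of_le (fun n => by positivity) (fun n => ?_)
  obtain rfl | hn := eq_or_ne n 0
  · simp [Real.rpow_nonneg]
  have hn1 : (1 : ℝ) ≤ |(n : ℝ)| := by exact_mod_cast Int.one_le_abs hn
  rw [max_eq_right (by rw [← sq_abs]; nlinarith), if_neg hn, add_zero, ← sq_abs,
    ← Real.rpow_natCast, ← Real.rpow_mul (abs_nonneg _)]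
  exact (congrArg _ (by push_cast; ring)).le

lemma integrable_one_add_sq_rpow {s : ℝ} (hs : 1 < s) :
    Integrable fun η : ℝ => (1 + (2 * Real.pi * η) ^ 2) ^ (-s / 2) := by
  have h := integrable_rpow_neg_one_add_norm_sq (E := ℝ) (μ := volume) (r := s) (by simpa)
  refine (h.comp_mul_left' (R := 2 * Real.pi) (by positivity)).congr (.of_forall fun η => ?_)
  simp only [Real.norm_eq_abs, sq_abs]

lemma inv_sobolevWeight_le {s : ℝ} (hs : 0 ≤ s) (k : ℤ × ℝ) :
    (sobolevWeight s k)⁻¹ ≤ ENNReal.ofReal (max 1 ((k.1 : ℝ) ^ 2) ^ (-s / 2))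
      * ENNReal.ofReal ((1 + (2 * Real.pi * k.2) ^ 2) ^ (-s / 2)) := by
  have hneg : -s / 2 ≤ 0 := by linarith
  have hsplit : (freqSq k ^ s)⁻¹ = freqSq k ^ (-s / 2) * freqSq k ^ (-s / 2) := by
    rw [← Real.rpow_neg (freqSq_pos k).le, ← Real.rpow_add (freqSq_pos k)]; congr 1; ring
  rw [sobolevWeight, ← ENNReal.ofReal_inv_of_pos (Real.rpow_pos_of_pos (freqSq_pos k) s),
    ← ENNReal.ofReal_mul (by positivity), hsplit]
  exact ENNReal.ofReal_le_ofReal (mul_le_mul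
    (Real.rpow_le_rpow_of_nonpos (by positivity) (max_one_sq_le_freqSq k) hneg)
    (Real.rpow_le_rpow_of_nonpos (by positivity) (one_add_sq_le_freqSq k) hneg)
    (Real.rpow_nonneg (freqSq_pos k).le _) (by positivity))

lemma lintegral_inv_sobolevWeight_ne_top {s : ℝ} (hs : 1 < s) :
    ∫⁻ k, (sobolevWeight s k)⁻¹ ∂modeMeasure ≠ ∞ := by
  have hη := integrable_one_add_sq_rpow hs
  refine ((lintegral_mono fun k => inv_sobolevWeight_le (zero_le_one.trans hs.le) k).trans_lt
    ?_).ne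
  rw [lintegral_prod_mul (f := fun p : ℤ => ENNReal.ofReal (max 1 ((p : ℝ) ^ 2) ^ (-s / 2)))
    (g := fun η : ℝ => ENNReal.ofReal ((1 + (2 * Real.pi * η) ^ 2) ^ (-s / 2)))
    (measurable_of_countable _).aemeasurable hη.1.aemeasurable.ennreal_ofReal, lintegral_count,
    ← ENNReal.ofReal_tsum_of_nonneg (fun n => by positivity) (summable_max_one_sq_rpow hs)]
  exact ENNReal.mul_lt_top ENNReal.ofReal_lt_top hη.lintegral_lt_top

lemma isConvolutionWeight_sobolevWeight {s : ℝ} (hs : 1 < s) :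
    IsConvolutionWeight modeMeasure (sobolevWeight s) (4 ^ s : ℝ).toNNReal where
  measurable := (measurable_freqSq.pow_const s).ennreal_ofReal
  ne_zero k := by simpa [sobolevWeight] using Real.rpow_pos_of_pos (freqSq_pos k) s
  ne_top _ := ENNReal.ofReal_ne_top
  add_le := sobolevWeight_add_le (zero_le_one.trans hs.le)
  lintegral_inv_ne_top := lintegral_inv_sobolevWeight_ne_top hs

/-! ### Mode functions of a Fourier density -/

lemma ae_slice {P : ℤ × ℝ → Prop} (h : ∀ᵐ k ∂modeMeasure, P k) (p : ℤ) : ∀ᵐ η : ℝ, P (p, η) :=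
  Measure.ae_count_iff.1 (Measure.ae_ae_of_ae_prod h) p

lemma ae_of_slice {P : ℤ × ℝ → Prop} (h : ∀ p : ℤ, ∀ᵐ η : ℝ, P (p, η)) :
    ∀ᵐ k ∂modeMeasure, P k := by
  have hsub : {k : ℤ × ℝ | ¬ P k} ⊆ ⋃ p : ℤ, {p} ×ˢ {η : ℝ | ¬ P (p, η)} := fun k hk =>
    Set.mem_iUnion.2 ⟨k.1, rfl, hk⟩
  refine measure_mono_null hsub (measure_iUnion_null fun p => ?_)
  rw [Measure.prod_prod, show volume {η : ℝ | ¬ P (p, η)} = 0 from h p, mul_zero]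

section Slices

variable {F : Type*} [NormedAddCommGroup F] {φ : ℤ × ℝ → F}

lemma integrable_slice (h : Integrable φ modeMeasure) (p : ℤ) : Integrable fun η => φ (p, η) :=
  Measure.ae_count_iff.1 h.prod_right_ae p

lemma integral_modeMeasure [NormedSpace ℝ F] [CompleteSpace F] (h : Integrable φ modeMeasure) :
    ∫ k, φ k ∂modeMeasure = ∑' p : ℤ, ∫ η : ℝ, φ (p, η) := by
  rw [integral_prod _ h, integral_countable h.integral_prod_left]
  simp

lemma summable_integral_norm_slice (h : Integrable φ modeMeasure) :
    Summable fun p : ℤ => ∫ η : ℝ, ‖φ (p, η)‖ := by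
  refine (integrable_count_iff.1 h.integral_norm_prod_left).congr fun p => ?_
  exact Real.norm_of_nonneg (integral_nonneg fun _ => norm_nonneg _)

end Slices

/-- The mode functions `U_p` of a function `U(ζ, φ) = ∑ U_p(ζ) e^{ipφ}`, in terms of the Fourier
density `(p, η) ↦ Û_p(η)`, which is real-valued when `U` is real and reversible. -/
noncomputable def modes (φ : ℤ × ℝ → ℝ) (p : ℤ) (x : ℝ) : ℂ :=
  𝓕⁻ (fun η : ℝ => (φ (p, η) : ℂ)) x

lemma modes_eq (φ : ℤ × ℝ → ℝ) (p : ℤ) (x : ℝ) :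
    modes φ p x = ∫ η : ℝ, (Real.fourierChar (η * x) : ℂ) * φ (p, η) := by
  simp [modes, Real.fourierInv_eq, mul_comm x, Circle.smul_def]

section Modes

variable {φ ψ : ℤ × ℝ → ℝ}

lemma modes_congr_ae (h : φ =ᵐ[modeMeasure] ψ) : modes φ = modes ψ := by
  ext p x
  refine Real.fourierInv_congr_ae ?_ x
  filter_upwards [ae_slice h p] with η hη
  rw [hη]

lemma norm_modes_le (φ : ℤ × ℝ → ℝ) (p : ℤ) (x : ℝ) : ‖modes φ p x‖ ≤ ∫ η : ℝ, ‖φ (p, η)‖ :=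
  (norm_fourierInv_le _ x).trans_eq (by simp)

lemma continuous_modes (h : Integrable φ modeMeasure) (p : ℤ) : Continuous (modes φ p) :=
  continuous_fourierInv (integrable_slice h p).ofReal

lemma conj_modes (φ : ℤ × ℝ → ℝ) (p : ℤ) (x : ℝ) : conj (modes φ p x) = modes φ p (-x) := by
  simp only [modes, conj_fourierInv, Complex.conj_ofReal]

lemma modes_neg (h : ∀ᵐ k ∂modeMeasure, φ (-k) = φ k) (p : ℤ) (x : ℝ) :
    modes φ (-p) x = conj (modes φ p x) := by
  rw [conj_modes, modes_eq, modes_eq, ← integral_neg_eq_self]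
  refine integral_congr_ae ?_
  filter_upwards [ae_slice h p] with η hη
  rw [Prod.neg_mk] at hη
  simp [hη]

lemma modes_eq_zero {p : ℤ} (h : ∀ᵐ η : ℝ, φ (p, η) = 0) (x : ℝ) : modes φ p x = 0 := by
  rw [modes_eq]
  exact integral_eq_zero_of_ae (h.mono fun η hη => by simp [hη])

lemma ae_eq_of_modes_eq (hφ : Integrable φ modeMeasure) (hψ : Integrable ψ modeMeasure)
    (he : ∀ p x, modes φ p x = modes ψ p x) : φ =ᵐ[modeMeasure] ψ := by
  refine ae_of_slice fun p => ?_
  filter_upwards [ae_eq_of_fourierInv_eq (integrable_slice hφ p).ofReal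
    (integrable_slice hψ p).ofReal (he p)] with η hη
  exact_mod_cast hη

lemma integrable_fourierChar_mul {f : ℝ → ℂ} (hf : Integrable f) (x : ℝ) :
    Integrable fun η : ℝ => (Real.fourierChar (η * x) : ℂ) * f η :=
  hf.bdd_mul (c := 1) (by fun_prop) (.of_forall fun η => (Circle.norm_coe _).le)

lemma modes_add (hφ : Integrable φ modeMeasure) (hψ : Integrable ψ modeMeasure) (p : ℤ) (x : ℝ) :
    modes (fun k => φ k + ψ k) p x = modes φ p x + modes ψ p x := by
  simp only [modes_eq, Complex.ofReal_add, mul_add]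
  exact integral_add (integrable_fourierChar_mul (integrable_slice hφ p).ofReal x)
    (integrable_fourierChar_mul (integrable_slice hψ p).ofReal x)

lemma modes_const_mul (c : ℝ) (φ : ℤ × ℝ → ℝ) (p : ℤ) (x : ℝ) :
    modes (fun k => c * φ k) p x = c * modes φ p x := by
  simp only [modes_eq, Complex.ofReal_mul, ← integral_const_mul]
  exact integral_congr_ae (.of_forall fun η => by ring)

lemma summable_norm_modes (h : Integrable φ modeMeasure) (x : ℝ) :
    Summable fun p => ‖modes φ p x‖ :=
  (summable_integral_norm_slice h).of_nonneg_of_le (fun _ => norm_nonneg _)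
    (fun p => norm_modes_le φ p x)

lemma norm_modes_le_integral (h : Integrable φ modeMeasure) (p : ℤ) (x : ℝ) :
    ‖modes φ p x‖ ≤ ∫ k, ‖φ k‖ ∂modeMeasure := by
  rw [integral_modeMeasure h.norm]
  exact (norm_modes_le φ p x).trans ((summable_integral_norm_slice h).le_tsum p
    fun _ _ => integral_nonneg fun _ => norm_nonneg _)

end Modes

section Convolution

variable {f g : ℤ × ℝ → ℝ}

lemma integral_fourierChar_mul (hf : Integrable f modeMeasure) (x : ℝ) {c : ℤ → ℂ} {M : ℝ}
    (hc : ∀ q, ‖c q‖ ≤ M) :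
    ∫ k : ℤ × ℝ, (Real.fourierChar (k.2 * x) : ℂ) * f k * c k.1 ∂modeMeasure
      = ∑' q, modes f q x * c q := by
  have hint : Integrable (fun k : ℤ × ℝ => (Real.fourierChar (k.2 * x) : ℂ) * f k * c k.1)
      modeMeasure :=
    (hf.ofReal.bdd_mul (c := 1) (by fun_prop) (.of_forall fun k => (Circle.norm_coe _).le)).mul_bdd
      (c := M) ((measurable_of_countable c).comp measurable_fst).aestronglyMeasurable
      (.of_forall fun k => hc k.1)
  rw [integral_modeMeasure hint]
  simp only [integral_mul_const, modes_eq]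

lemma modes_eq_integral (hf : Integrable f modeMeasure) (p : ℤ) (x : ℝ) :
    modes f p x
      = ∫ k : ℤ × ℝ, (Real.fourierChar (k.2 * x) : ℂ) * f k * (if k.1 = p then 1 else 0)
          ∂modeMeasure := by
  rw [integral_fourierChar_mul hf x (c := fun q => if q = p then 1 else 0) (M := 1)
    (fun q => by split_ifs <;> simp)]
  simp

lemma integral_shifted_modes (hg : Integrable g modeMeasure) (p : ℤ) (x : ℝ) (a : ℤ × ℝ) :
    ∫ k : ℤ × ℝ, (Real.fourierChar (k.2 * x) : ℂ) * g (k - a) * (if k.1 = p then 1 else 0)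
        ∂modeMeasure
      = Real.fourierChar (a.2 * x) * modes g (p - a.1) x := by
  rw [← integral_add_right_eq_self _ a, modes_eq_integral hg, ← integral_const_mul]
  refine integral_congr_ae (.of_forall fun k => ?_)
  simp only [Prod.snd_add, Prod.fst_add, add_sub_cancel_right, add_mul, eq_sub_iff_add_eq,
    AddChar.map_add_eq_mul, Circle.coe_mul]
  ring

lemma modes_convolution (hf : Integrable f modeMeasure) (hg : Integrable g modeMeasure) (p : ℤ)
    (x : ℝ) :
    modes (f ⋆[ContinuousLinearMap.mul ℝ ℝ, modeMeasure] g) p x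
      = ∑' q, modes f q x * modes g (p - q) x := by
  set χ : ℤ × ℝ → ℂ := fun k => Real.fourierChar (k.2 * x) * (if k.1 = p then 1 else 0) with hχ
  have hχ_meas : Measurable χ :=
    Measurable.mul (by fun_prop)
      ((measurable_of_countable fun q : ℤ => if q = p then (1 : ℂ) else 0).comp measurable_fst)
  have hχ_le (k) : ‖χ k‖ ≤ 1 := by
    rw [hχ, norm_mul, Circle.norm_coe]; split_ifs <;> simp
  have hint : Integrable (fun z : (ℤ × ℝ) × (ℤ × ℝ) => χ z.1 * ((f z.2 * g (z.1 - z.2) : ℝ) : ℂ))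
      (modeMeasure.prod modeMeasure) :=
    (hf.convolution_integrand (ContinuousLinearMap.mul ℝ ℝ) hg).ofReal.bdd_mul (c := 1)
      (hχ_meas.comp measurable_fst).aestronglyMeasurable (.of_forall fun z => hχ_le z.1)
  calc _ = ∫ k, ∫ a, χ k * ((f a * g (k - a) : ℝ) : ℂ) ∂modeMeasure ∂modeMeasure := by
        rw [modes_eq_integral (hf.integrable_convolution _ hg)]
        refine integral_congr_ae (.of_forall fun k => ?_)
        simp only [convolution_def, ContinuousLinearMap.mul_apply', integral_const_mul,
          integral_complex_ofReal, hχ]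
        ring
    _ = ∫ a, (Real.fourierChar (a.2 * x) : ℂ) * f a * modes g (p - a.1) x ∂modeMeasure := by
        rw [integral_integral_swap hint]
        refine integral_congr_ae (.of_forall fun a => ?_)
        dsimp only
        rw [mul_right_comm, ← integral_shifted_modes hg, ← integral_mul_const]
        refine integral_congr_ae (.of_forall fun k => ?_)
        simp only [hχ, Complex.ofReal_mul]
        ring
    _ = _ := integral_fourierChar_mul hf x (c := fun q => modes g (p - q) x)
        fun q => norm_modes_le_integral hg (p - q) x

lemma summable_modes_mul_modes (hf : Integrable f modeMeasure) (hg : Integrable g modeMeasure)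
    (σ : ℤ → ℤ) (x : ℝ) : Summable fun q => modes f q x * modes g (σ q) x := by
  refine .of_norm_bounded ((summable_norm_modes hf x).mul_right (∫ k, ‖g k‖ ∂modeMeasure))
    fun q => ?_
  rw [norm_mul]
  gcongr
  exact norm_modes_le_integral hg _ _

lemma summable_modes_triple {h : ℤ × ℝ → ℝ} (hf : Integrable f modeMeasure)
    (hg : Integrable g modeMeasure) (hh : Integrable h modeMeasure) (p : ℤ) (x : ℝ) :
    Summable fun z : ℤ × ℤ => modes f z.1 x * modes g z.2 x * modes h (p - z.1 - z.2) x := by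
  refine .of_norm_bounded (((summable_norm_modes hf x).mul_of_nonneg (summable_norm_modes hg x)
    (fun _ => norm_nonneg _) (fun _ => norm_nonneg _)).mul_right (∫ k, ‖h k‖ ∂modeMeasure))
    fun z => ?_
  rw [norm_mul, norm_mul]
  gcongr
  exact norm_modes_le_integral hh _ _

end Convolution

/-! ### Densities of reversible functions -/

/-- Real Fourier densities on the frequency space whose functions have Sobolev regularity `s`. -/
noncomputable abbrev SobolevDensity (s : ℝ) : Type :=
  Lp ℝ 2 (modeMeasure.withDensity (sobolevWeight s))

lemma measurable_sobolevWeight (s : ℝ) : Measurable (sobolevWeight s) :=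
  (measurable_freqSq.pow_const s).ennreal_ofReal

lemma ae_sobolev_eq (s : ℝ) : ae (modeMeasure.withDensity (sobolevWeight s)) = ae modeMeasure :=
  ae_withDensity_eq (measurable_sobolevWeight s) fun k =>
    (ENNReal.ofReal_pos.2 (Real.rpow_pos_of_pos (freqSq_pos k) s)).ne'

lemma measurePreserving_neg_sobolev (s : ℝ) :
    MeasurePreserving Neg.neg (modeMeasure.withDensity (sobolevWeight s))
      (modeMeasure.withDensity (sobolevWeight s)) := by
  refine ⟨measurable_neg, Measure.ext fun S hS => ?_⟩
  rw [Measure.map_apply measurable_neg hS, withDensity_apply _ hS,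
    withDensity_apply _ (measurable_neg hS),
    ← (Measure.measurePreserving_neg modeMeasure).setLIntegral_comp_preimage hS
      (measurable_sobolevWeight s)]
  simp only [sobolevWeight, freqSq_neg]

lemma memLp_top_of_abs_le_one {α : Type*} [MeasurableSpace α] {ν : Measure α} {m : α → ℝ}
    (hm : Measurable m) (h : ∀ k, |m k| ≤ 1) : MemLp m ∞ ν :=
  memLp_top_of_bound hm.aestronglyMeasurable 1 (.of_forall h)

section ReversibleDensity

variable {s : ℝ}

/-- The restriction of a density to the modes in `S`. -/
noncomputable def modeCutoff (s : ℝ) (S : Set ℤ) : SobolevDensity s →L[ℝ] SobolevDensity s :=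
  multiplier (m := fun k => S.indicator 1 k.1) <| memLp_top_of_abs_le_one
    ((measurable_of_countable (S.indicator (1 : ℤ → ℝ))).comp measurable_fst)
    fun k => by by_cases h : k.1 ∈ S <;> simp [h]

lemma coeFn_modeCutoff (S : Set ℤ) (f : SobolevDensity s) :
    modeCutoff s S f =ᵐ[modeMeasure] fun k => S.indicator 1 k.1 * f k := by
  rw [Filter.EventuallyEq, ← ae_sobolev_eq s]
  exact coeFn_multiplier _ f

/-- The densities of the real, reversible functions without even modes. -/
noncomputable def reversibleDensity (s : ℝ) : Submodule ℝ (SobolevDensity s) :=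
  ((Lp.compMeasurePreservingₗᵢ ℝ Neg.neg
      (measurePreserving_neg_sobolev s)).toContinuousLinearMap - .id ℝ (SobolevDensity s)).ker
    ⊓ (modeCutoff s {p | Even p}).ker

instance : CompleteSpace (reversibleDensity s) :=
  ((ContinuousLinearMap.isClosed_ker _).inter
    (ContinuousLinearMap.isClosed_ker _)).completeSpace_coe

lemma mem_reversibleDensity_iff {f : SobolevDensity s} : f ∈ reversibleDensity s ↔
    (∀ᵐ k ∂modeMeasure, f (-k) = f k) ∧ ∀ᵐ k ∂modeMeasure, Even k.1 → f k = 0 := by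
  have hneg := Lp.coeFn_compMeasurePreserving f (measurePreserving_neg_sobolev s)
  have hcut := coeFn_modeCutoff {p | Even p} f
  rw [Filter.EventuallyEq, ae_sobolev_eq] at hneg
  rw [reversibleDensity, Submodule.mem_inf, LinearMap.mem_ker, LinearMap.mem_ker]
  refine and_congr (Iff.trans (b := Lp.compMeasurePreserving Neg.neg
    (measurePreserving_neg_sobolev s) f = f) sub_eq_zero ?_) ?_
  · rw [Lp.ext_iff, Filter.EventuallyEq, ae_sobolev_eq]
    refine Filter.eventually_congr (hneg.mono fun k hk => ?_)
    rw [hk, Function.comp_apply]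
  · rw [ContinuousLinearMap.coe_coe, Lp.eq_zero_iff_ae_eq_zero, Filter.EventuallyEq,
      ae_sobolev_eq]
    refine Filter.eventually_congr (hcut.mono fun k hk => ?_)
    by_cases h : Even k.1 <;> simp [hk, h]

lemma multiplier_mem_reversibleDensity {m : ℤ × ℝ → ℝ}
    (hm : MemLp m ∞ (modeMeasure.withDensity (sobolevWeight s))) (hneg : ∀ k, m (-k) = m k)
    {f : SobolevDensity s} (hf : f ∈ reversibleDensity s) :
    multiplier hm f ∈ reversibleDensity s := by
  have hmul := coeFn_multiplier hm f
  rw [Filter.EventuallyEq, ae_sobolev_eq] at hmul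
  have hmul' := (Measure.measurePreserving_neg modeMeasure).quasiMeasurePreserving.ae hmul
  obtain ⟨hf₁, hf₂⟩ := mem_reversibleDensity_iff.1 hf
  refine mem_reversibleDensity_iff.2 ⟨?_, ?_⟩
  · filter_upwards [hmul, hmul', hf₁] with k h₁ h₂ h₃
    rw [h₁, h₂, hneg, h₃]
  · filter_upwards [hmul, hf₂] with k h₁ h₂ hk
    rw [h₁, h₂ hk, mul_zero]

lemma integrable_sobolevDensity (hs : 1 < s) (f : SobolevDensity s) : Integrable f modeMeasure :=
  (isConvolutionWeight_sobolevWeight hs).integrable_coeFn f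

lemma modes_modeCutoff (S : Set ℤ) (f : SobolevDensity s) (p : ℤ) (x : ℝ) :
    modes (modeCutoff s S f) p x = S.indicator (fun q => modes f q x) p := by
  rw [modes_congr_ae (coeFn_modeCutoff S f), modes_eq]
  by_cases h : p ∈ S <;> simp [h, modes_eq]

lemma modes_sobolevDensity_add (hs : 1 < s) (f g : SobolevDensity s) (p : ℤ) (x : ℝ) :
    modes (f + g : SobolevDensity s) p x = modes f p x + modes g p x := by
  have h := Lp.coeFn_add f g
  rw [Filter.EventuallyEq, ae_sobolev_eq] at h
  rw [modes_congr_ae h]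
  exact modes_add (integrable_sobolevDensity hs f) (integrable_sobolevDensity hs g) p x

lemma modes_sobolevDensity_smul (c : ℝ) (f : SobolevDensity s) (p : ℤ) (x : ℝ) :
    modes (c • f : SobolevDensity s) p x = c * modes f p x := by
  have h := Lp.coeFn_smul c f
  rw [Filter.EventuallyEq, ae_sobolev_eq] at h
  rw [modes_congr_ae h]
  exact modes_const_mul c f p x

section Symmetries

variable {f : SobolevDensity s} (hf : f ∈ reversibleDensity s)

include hf

lemma modes_neg_of_mem (p : ℤ) (x : ℝ) : modes f (-p) x = conj (modes f p x) :=
  modes_neg (mem_reversibleDensity_iff.1 hf).1 p x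

lemma modes_eq_zero_of_mem {p : ℤ} (hp : Even p) (x : ℝ) : modes f p x = 0 :=
  modes_eq_zero ((ae_slice (mem_reversibleDensity_iff.1 hf).2 p).mono fun _ h => h hp) x

end Symmetries

lemma mem_reversibleDensity_of_modes (hs : 1 < s) {f : SobolevDensity s}
    (hreal : ∀ p x, modes f (-p) x = conj (modes f p x))
    (heven : ∀ p, Even p → ∀ x, modes f p x = 0) : f ∈ reversibleDensity s := by
  have hf := integrable_sobolevDensity hs f
  refine mem_reversibleDensity_iff.2 ⟨ae_eq_of_modes_eq hf.comp_neg hf fun p x => ?_, ?_⟩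
  · rw [← Complex.conj_conj (modes f p x), ← hreal, conj_modes, modes_eq, modes_eq,
      ← integral_neg_eq_self]
    simp
  · have h : modeCutoff s {p | Even p} f =ᵐ[modeMeasure] (0 : ℤ × ℝ → ℝ) :=
      ae_eq_of_modes_eq (integrable_sobolevDensity hs _) (integrable_zero _ _ _) fun p x => by
        rw [modes_modeCutoff, modes_eq_zero (φ := 0) (.of_forall fun _ => rfl)]
        by_cases hp : Even p
        · simp [hp, heven p hp x]
        · simp [hp]
    filter_upwards [h, coeFn_modeCutoff {p | Even p} f] with k h₁ h₂ hk
    rw [h₁] at h₂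
    simpa [hk] using h₂.symm

end ReversibleDensity

/-! ### The cubic nonlinearity -/

lemma tsum_oddInt {F : ℤ → ℂ} (h : ∀ q, Even q → F q = 0) :
    ∑' q : OddInt, F q = ∑' q : ℤ, F q :=
  Subtype.val_injective.tsum_eq fun q hq =>
    ⟨⟨q, Int.not_even_iff_odd.1 fun he => hq (h q he)⟩, rfl⟩

lemma tsum_oddInt_prod {F : ℤ × ℤ → ℂ} (h : ∀ z : ℤ × ℤ, Even z.1 ∨ Even z.2 → F z = 0) :
    ∑' z : OddInt × OddInt, F (z.1, z.2) = ∑' z : ℤ × ℤ, F z :=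
  (Subtype.val_injective.prodMap Subtype.val_injective).tsum_eq (f := F) fun z hz =>
    ⟨(⟨z.1, Int.not_even_iff_odd.1 fun he => hz (h z (.inl he))⟩,
      ⟨z.2, Int.not_even_iff_odd.1 fun he => hz (h z (.inr he))⟩), rfl⟩

section CubicForm

variable {E : Type*} [NormedAddCommGroup E] [NormedSpace ℝ E] (B : E →L[ℝ] E →L[ℝ] E)
  (M : E →L[ℝ] E)

/-- The nonlinearity `3 M(b²) a + a³` for a product `B` and an averaging operator `M`. -/
noncomputable def cubicForm (a b : E) : E :=
  (3 : ℝ) • B a (M (B b b)) + B a (B a a)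

lemma cubicForm_smul_smul {c d : ℝ} (hcd : d ^ 2 = c ^ 2) (a b : E) :
    cubicForm B M (c • a) (d • b) = c ^ 3 • cubicForm B M a b := by
  simp only [cubicForm, map_smul, FunLike.coe_smul, Pi.smul_apply, smul_add, smul_smul]
  congr 2
  · linear_combination (3 * c) * hcd
  · ring

lemma contDiff_cubicForm {n : WithTop ℕ∞} :
    ContDiff ℝ n fun z : E × E => cubicForm B M z.1 z.2 := by
  unfold cubicForm
  fun_prop

/-- The derivative of `u ↦ 3 M(u²) u + u³` for a commutative product. -/
noncomputable def cubicFormDeriv (u : E) : E →L[ℝ] E :=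
  (3 : ℝ) • (B.flip (M (B u u)) + (2 : ℝ) • (B u ∘L M ∘L B u))
    + (B.flip (B u u) + (2 : ℝ) • (B u ∘L B u))

lemma cubicFormDeriv_apply (u w : E) : cubicFormDeriv B M u w =
    (3 : ℝ) • (B w (M (B u u)) + (2 : ℝ) • B u (M (B u w)))
      + (B w (B u u) + (2 : ℝ) • B u (B u w)) := rfl

lemma hasFDerivAt_cubicForm (hB : ∀ f g, B f g = B g f) (u : E) :
    HasFDerivAt (fun v => cubicForm B M v v) (cubicFormDeriv B M u) u := by
  have hmul {F : E → E} {F' : E →L[ℝ] E} (hF : HasFDerivAt F F' u) :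
      HasFDerivAt (fun v => B v (F v)) (B.flip (F u) + B u ∘L F') u :=
    (B.hasFDerivAt_of_bilinear (hasFDerivAt_id u) hF).congr_fderiv (by ext1 w; simp [add_comm])
  have hsq : HasFDerivAt (fun v => B v v) ((2 : ℝ) • B u) u :=
    (hmul (hasFDerivAt_id u)).congr_fderiv (by ext1 w; simp [hB w u, two_smul])
  have hmean : HasFDerivAt (fun v => M (B v v)) ((2 : ℝ) • M ∘L B u) u :=
    (M.hasFDerivAt.comp u hsq).congr_fderiv (by ext1 w; simp)
  refine (((hmul hmean).const_smul (3 : ℝ)).add (hmul hsq)).congr_fderiv ?_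
  ext1 w
  simp [cubicFormDeriv_apply]

end CubicForm

section Nonlinearity

variable {s : ℝ} (hs : 1 < s)

/-- The density of the product of two functions. -/
noncomputable def productDensity :
    SobolevDensity s →L[ℝ] SobolevDensity s →L[ℝ] SobolevDensity s :=
  (isConvolutionWeight_sobolevWeight hs).conv

lemma productDensity_comm (f g : SobolevDensity s) :
    productDensity hs f g = productDensity hs g f :=
  (isConvolutionWeight_sobolevWeight hs).conv_comm f g

lemma modes_productDensity (f g : SobolevDensity s) (p : ℤ) (x : ℝ) :
    modes (productDensity hs f g) p x = ∑' q, modes f q x * modes g (p - q) x := by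
  rw [← modes_convolution (integrable_sobolevDensity hs f) (integrable_sobolevDensity hs g),
    productDensity, modes_congr_ae ((isConvolutionWeight_sobolevWeight hs).coeFn_conv f g)]

lemma modes_productDensity_productDensity (f g h : SobolevDensity s) (p : ℤ) (x : ℝ) :
    modes (productDensity hs f (productDensity hs g h)) p x
      = ∑' z : ℤ × ℤ, modes f z.1 x * modes g z.2 x * modes h (p - z.1 - z.2) x := by
  rw [(summable_modes_triple (integrable_sobolevDensity hs f) (integrable_sobolevDensity hs g)
    (integrable_sobolevDensity hs h) p x).tsum_prod, modes_productDensity]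
  simp only [modes_productDensity, mul_assoc, tsum_mul_left]

lemma modes_productDensity_mean (f g : SobolevDensity s) (p : ℤ) (x : ℝ) :
    modes (productDensity hs f (modeCutoff s {0} g)) p x = modes f p x * modes g 0 x := by
  rw [modes_productDensity, tsum_eq_single p]
  · simp [modes_modeCutoff]
  · intro q hq
    simp [modes_modeCutoff, sub_eq_zero, hq.symm]

/-- The density of `3 (1/2π ∫ b² dφ) a + a³`. -/
noncomputable def cubicDensity (a b : SobolevDensity s) : SobolevDensity s :=
  cubicForm (productDensity hs) (modeCutoff s {0}) a b

/-- The derivative of `u ↦ 3 (1/2π ∫ u² dφ) u + u³`, in terms of densities. -/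
noncomputable def cubicDensityDeriv (u : SobolevDensity s) :
    SobolevDensity s →L[ℝ] SobolevDensity s :=
  cubicFormDeriv (productDensity hs) (modeCutoff s {0}) u

variable {a b : SobolevDensity s}

lemma tsum_norm_sq_modes (hb : b ∈ reversibleDensity s) (x : ℝ) :
    (((∑' q : OddInt, (‖modes b q x‖ ^ 2 : ℝ) : ℝ)) : ℂ)
      = modes (productDensity hs b b) 0 x := by
  rw [Complex.ofReal_tsum, modes_productDensity,
    ← tsum_oddInt fun q hq => by rw [modes_eq_zero_of_mem hb hq, zero_mul]]
  refine tsum_congr fun q => ?_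
  rw [zero_sub, modes_neg_of_mem hb, Complex.mul_conj', Complex.ofReal_pow]

lemma tsum_modes_triple (ha : a ∈ reversibleDensity s) (f : SobolevDensity s) (p : ℤ) (x : ℝ) :
    ∑' z : OddInt × OddInt, modes a z.1 x * modes a z.2 x * modes f (p - z.1 - z.2) x
      = modes (productDensity hs a (productDensity hs a f)) p x := by
  rw [modes_productDensity_productDensity]
  refine tsum_oddInt_prod (F := fun z => modes a z.1 x * modes a z.2 x * modes f (p - z.1 - z.2) x)
    fun z hz => ?_
  rcases hz with hz | hz <;> simp [modes_eq_zero_of_mem ha hz]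

lemma modes_cubicDensity (ha : a ∈ reversibleDensity s) (hb : b ∈ reversibleDensity s) (p : ℤ)
    (x : ℝ) : modes (cubicDensity hs a b) p x = cubic (modes a) (modes b) p x := by
  rw [cubicDensity, cubicForm, modes_sobolevDensity_add hs, modes_sobolevDensity_smul,
    modes_productDensity_mean, cubic, tsum_norm_sq_modes hs hb, tsum_modes_triple hs ha]
  push_cast
  ring

lemma two_mul_modes_productDensity (ha : a ∈ reversibleDensity s) (hb : b ∈ reversibleDensity s)
    (x : ℝ) :
    2 * modes (productDensity hs a b) 0 x
      = (∑' q : OddInt, 2 * (conj (modes a q x) * modes b q x).re : ℝ) := by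
  have hsum (f g : SobolevDensity s) :=
    summable_modes_mul_modes (integrable_sobolevDensity hs f) (integrable_sobolevDensity hs g)
      (fun q => 0 - q) x
  have heven (q : ℤ) (hq : Even q) : modes a q x * modes b (0 - q) x
      + modes b q x * modes a (0 - q) x = 0 := by
    rw [modes_eq_zero_of_mem ha hq, modes_eq_zero_of_mem hb hq, zero_mul, zero_mul, add_zero]
  rw [two_mul]
  nth_rw 2 [productDensity_comm]
  rw [modes_productDensity, modes_productDensity, ← (hsum a b).tsum_add (hsum b a),
    ← tsum_oddInt heven, Complex.ofReal_tsum]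
  refine tsum_congr fun q => ?_
  rw [zero_sub, modes_neg_of_mem ha, modes_neg_of_mem hb, Complex.ofReal_mul,
    Complex.re_eq_add_conj, map_mul, Complex.conj_conj]
  push_cast
  ring

lemma modes_cubicDensityDeriv (ha : a ∈ reversibleDensity s) (hb : b ∈ reversibleDensity s)
    (p : ℤ) (x : ℝ) :
    modes (cubicDensityDeriv hs a b) p x = cubicDeriv (modes a) (modes b) p x := by
  have hassoc : modes (productDensity hs b (productDensity hs a a)) p x
      = modes (productDensity hs a (productDensity hs a b)) p x := by
    rw [modes_productDensity_productDensity, modes_productDensity_productDensity]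
    let reflect : ℤ × ℤ ≃ ℤ × ℤ := Function.Involutive.toPerm (fun z => (p - z.1 - z.2, z.2))
      fun z => Prod.ext (by ring) rfl
    rw [← reflect.tsum_eq]
    refine tsum_congr fun z => ?_
    change modes b (p - z.1 - z.2) x * modes a z.2 x * modes a (p - (p - z.1 - z.2) - z.2) x = _
    rw [show p - (p - z.1 - z.2) - z.2 = z.1 by ring]
    ring
  simp only [cubicDensityDeriv, cubicFormDeriv_apply, modes_sobolevDensity_add hs,
    modes_sobolevDensity_smul, modes_productDensity_mean, hassoc]
  rw [cubicDeriv, tsum_norm_sq_modes hs ha, tsum_modes_triple hs ha,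
    ← two_mul_modes_productDensity hs ha hb]
  push_cast
  ring

end Nonlinearity

section SubmoduleCubicForm

variable {E F : Type*} [NormedAddCommGroup E] [NormedSpace ℝ E] [NormedAddCommGroup F]
  [NormedSpace ℝ F] (B : E →L[ℝ] E →L[ℝ] E) (M : E →L[ℝ] E) (T : E →L[ℝ] F) (X : Submodule ℝ E)

lemma contDiff_comp_cubicForm_subtype {n : WithTop ℕ∞} :
    ContDiff ℝ n fun z : X × X => T (cubicForm B M z.1 z.2) :=
  T.contDiff.comp ((contDiff_cubicForm B M).comp (X.subtypeL.prodMap X.subtypeL).contDiff)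

lemma hasFDerivAt_comp_cubicForm_subtype (hB : ∀ f g, B f g = B g f) (u : X) :
    HasFDerivAt (fun v : X => T (cubicForm B M v v))
      (T ∘L cubicFormDeriv B M u ∘L X.subtypeL) u :=
  T.hasFDerivAt.comp u ((hasFDerivAt_cubicForm B M hB (u : E)).comp u X.subtypeL.hasFDerivAt)

end SubmoduleCubicForm

section ReversibleNonlinearity

variable {s : ℝ} (hs : 1 < s)

lemma modes_productDensity_neg {f g : SobolevDensity s}
    (hf : ∀ p x, modes f (-p) x = conj (modes f p x))
    (hg : ∀ p x, modes g (-p) x = conj (modes g p x)) (p : ℤ) (x : ℝ) :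
    modes (productDensity hs f g) (-p) x = conj (modes (productDensity hs f g) p x) := by
  rw [modes_productDensity, modes_productDensity, Complex.conj_tsum, ← (Equiv.neg ℤ).tsum_eq]
  refine tsum_congr fun q => ?_
  rw [Equiv.neg_apply, ← neg_sub', hf, hg, map_mul]

variable {a b c : SobolevDensity s}

lemma productDensity_productDensity_mem (ha : a ∈ reversibleDensity s)
    (hb : b ∈ reversibleDensity s) (hc : c ∈ reversibleDensity s) :
    productDensity hs a (productDensity hs b c) ∈ reversibleDensity s := by
  refine mem_reversibleDensity_of_modes hs (modes_productDensity_neg hs (modes_neg_of_mem ha)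
    (modes_productDensity_neg hs (modes_neg_of_mem hb) (modes_neg_of_mem hc))) fun p hp x => ?_
  rw [modes_productDensity_productDensity]
  refine (tsum_congr fun z => ?_).trans tsum_zero
  rcases Int.even_or_odd z.1 with h₁ | h₁
  · simp [modes_eq_zero_of_mem ha h₁]
  rcases Int.even_or_odd z.2 with h₂ | h₂
  · simp [modes_eq_zero_of_mem hb h₂]
  · simp [modes_eq_zero_of_mem hc ((hp.sub_odd h₁).sub_odd h₂)]

lemma productDensity_mean_mem (ha : a ∈ reversibleDensity s)
    (hb : b ∈ reversibleDensity s) (hc : c ∈ reversibleDensity s) :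
    productDensity hs a (modeCutoff s {0} (productDensity hs b c)) ∈ reversibleDensity s := by
  have hmean := modes_productDensity_neg hs (modes_neg_of_mem hb) (modes_neg_of_mem hc) 0
  refine mem_reversibleDensity_of_modes hs (fun p x => ?_) fun p hp x => ?_
  · rw [modes_productDensity_mean, modes_productDensity_mean, modes_neg_of_mem ha, map_mul,
      ← hmean, neg_zero]
  · rw [modes_productDensity_mean, modes_eq_zero_of_mem ha hp, zero_mul]

lemma cubicDensity_mem (ha : a ∈ reversibleDensity s) (hb : b ∈ reversibleDensity s) :
    cubicDensity hs a b ∈ reversibleDensity s :=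
  add_mem (Submodule.smul_mem _ _ (productDensity_mean_mem hs ha hb hb))
    (productDensity_productDensity_mem hs ha ha ha)

lemma cubicDensityDeriv_mem (ha : a ∈ reversibleDensity s) (hb : b ∈ reversibleDensity s) :
    cubicDensityDeriv hs a b ∈ reversibleDensity s := by
  rw [cubicDensityDeriv, cubicFormDeriv_apply]
  exact add_mem (Submodule.smul_mem _ _ (add_mem (productDensity_mean_mem hs hb ha ha)
    (Submodule.smul_mem _ _ (productDensity_mean_mem hs ha ha hb))))
    (add_mem (productDensity_productDensity_mem hs hb ha ha)
    (Submodule.smul_mem _ _ (productDensity_productDensity_mem hs ha ha hb)))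

/-- A symbol bounded by one whose Fourier multiplier preserves reversible functions. -/
structure IsReversibleSymbol (m : ℤ × ℝ → ℝ) : Prop where
  measurable : Measurable m
  abs_le_one : ∀ k, |m k| ≤ 1
  neg : ∀ k, m (-k) = m k

variable {m : ℤ × ℝ → ℝ} (hm : IsReversibleSymbol m)

/-- The Fourier multiplier with symbol `m` on reversible densities. The orthogonal projection only
restricts the codomain. -/
noncomputable def symbolOperator (s : ℝ) (hm : IsReversibleSymbol m) :
    SobolevDensity s →L[ℝ] reversibleDensity s :=
  (reversibleDensity s).orthogonalProjectionOnto ∘L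
    multiplier (memLp_top_of_abs_le_one hm.measurable hm.abs_le_one)

lemma coeFn_symbolOperator (hm : IsReversibleSymbol m) (ha : a ∈ reversibleDensity s) :
    (symbolOperator s hm a : SobolevDensity s) =ᵐ[modeMeasure] fun k => m k * a k := by
  have hmem := multiplier_mem_reversibleDensity
    (memLp_top_of_abs_le_one hm.measurable hm.abs_le_one) hm.neg ha
  rw [symbolOperator, ContinuousLinearMap.comp_apply,
    Submodule.orthogonalProjectionOnto_mem_subspace_eq_self (⟨_, hmem⟩ : reversibleDensity s),
    Filter.EventuallyEq, ← ae_sobolev_eq s]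
  exact coeFn_multiplier _ a

/-- The nonlinearity `3 (1/2π ∫ b² dφ) a + a³` of a pair `(a, b)` of reversible functions, filtered
by the symbol `m`. -/
noncomputable def filteredCubic (z : reversibleDensity s × reversibleDensity s) :
    reversibleDensity s :=
  symbolOperator s hm (cubicDensity hs z.1 z.2)

lemma coeFn_filteredCubic (z : reversibleDensity s × reversibleDensity s) :
    (filteredCubic hs hm z : SobolevDensity s)
      =ᵐ[modeMeasure] fun k => m k * cubicDensity hs (z.1 : SobolevDensity s) z.2 k :=
  coeFn_symbolOperator hm (cubicDensity_mem hs z.1.2 z.2.2)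

lemma contDiff_filteredCubic {n : WithTop ℕ∞} : ContDiff ℝ n (filteredCubic hs hm) :=
  contDiff_comp_cubicForm_subtype _ _ _ _

lemma filteredCubic_smul_smul {c d : ℝ} (hcd : d ^ 2 = c ^ 2) (a b : reversibleDensity s) :
    filteredCubic hs hm (c • a, d • b) = c ^ 3 • filteredCubic hs hm (a, b) := by
  simp only [filteredCubic, Submodule.coe_smul, cubicDensity]
  rw [cubicForm_smul_smul _ _ hcd, map_smul]

/-- The derivative of `u ↦ filteredCubic hs hm (u, u)`. -/
noncomputable def filteredCubicDeriv (u : reversibleDensity s) :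
    reversibleDensity s →L[ℝ] reversibleDensity s :=
  symbolOperator s hm ∘L cubicDensityDeriv hs u ∘L (reversibleDensity s).subtypeL

lemma coeFn_filteredCubicDeriv (u w : reversibleDensity s) :
    (filteredCubicDeriv hs hm u w : SobolevDensity s)
      =ᵐ[modeMeasure] fun k => m k * cubicDensityDeriv hs u w k :=
  coeFn_symbolOperator hm (cubicDensityDeriv_mem hs u.2 w.2)

lemma hasFDerivAt_filteredCubic (u : reversibleDensity s) :
    HasFDerivAt (fun v => filteredCubic hs hm (v, v)) (filteredCubicDeriv hs hm u) u :=
  hasFDerivAt_comp_cubicForm_subtype _ _ _ _ (productDensity_comm hs) u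

/-- The symbol `p² / (p² + ξ²)` of `∂_φ² (∂_ζ² + ∂_φ²)⁻¹`, where `ξ = 2πη`. -/
noncomputable def angularSymbol (k : ℤ × ℝ) : ℝ := (k.1 : ℝ) ^ 2 / freqSq k

/-- The symbol `p ξ / (p² + ξ²)` of `∂_φ ∂_ζ (∂_ζ² + ∂_φ²)⁻¹`, where `ξ = 2πη`. -/
noncomputable def mixedSymbol (k : ℤ × ℝ) : ℝ := k.1 * (2 * Real.pi * k.2) / freqSq k

lemma measurable_intCast_fst : Measurable fun k : ℤ × ℝ => (k.1 : ℝ) :=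
  (measurable_of_countable _).comp measurable_fst

lemma isReversibleSymbol_angularSymbol : IsReversibleSymbol angularSymbol where
  measurable := (measurable_intCast_fst.pow_const 2).div measurable_freqSq
  abs_le_one k := by
    rw [angularSymbol, abs_of_nonneg (div_nonneg (sq_nonneg _) (freqSq_pos k).le),
      div_le_one (freqSq_pos k)]
    exact (le_max_right 1 _).trans (max_one_sq_le_freqSq k)
  neg k := by simp [angularSymbol, freqSq_neg]

lemma isReversibleSymbol_mixedSymbol : IsReversibleSymbol mixedSymbol where
  measurable := (measurable_intCast_fst.mul (by fun_prop)).div measurable_freqSq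
  abs_le_one k := by
    rw [mixedSymbol, abs_div, abs_of_pos (freqSq_pos k), div_le_one (freqSq_pos k), abs_mul,
      freqSq]
    have hmax := le_max_right 1 ((k.1 : ℝ) ^ 2)
    nlinarith [two_mul_le_add_sq |(k.1 : ℝ)| |2 * Real.pi * k.2|, sq_abs (k.1 : ℝ),
      sq_abs (2 * Real.pi * k.2), sq_nonneg (k.1 : ℝ), sq_nonneg (2 * Real.pi * k.2)]
  neg k := by simp [mixedSymbol, freqSq_neg]

end ReversibleNonlinearity

/-! ### Identification of the reversible subspace with the densities -/

/-- The tempered distribution given by integration against an integrable function. -/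
noncomputable def temperedOf {ρ : ℝ → ℂ} (hρ : Integrable ρ) : 𝓢'(ℝ, ℂ) :=
  Lp.toTemperedDistribution ((memLp_one_iff_integrable.2 hρ).toLp ρ)

lemma represents_temperedOf {ρ : ℝ → ℂ} (hρ : Integrable ρ) : Represents (temperedOf hρ) ρ := by
  refine fun ψ => ⟨integrable_schwartz_mul ψ hρ, ?_⟩
  rw [temperedOf, Lp.toTemperedDistribution_apply]
  refine integral_congr_ae ?_
  filter_upwards [(memLp_one_iff_integrable.2 hρ).coeFn_toLp] with x hx
  rw [hx, smul_eq_mul]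

lemma represents_fourierInv_temperedOf {ρ : ℝ → ℂ} (hρ : Integrable ρ) :
    Represents (𝓕⁻ (temperedOf hρ)) (𝓕⁻ ρ) := fun ψ =>
  ⟨integrable_schwartz_mul_fourierInv ψ hρ, by
    rw [TemperedDistribution.fourierInv_apply, (represents_temperedOf hρ _).2,
      integral_schwartz_mul_fourierInv ψ hρ]⟩

lemma Represents.unique {T T' : 𝓢'(ℝ, ℂ)} {f : ℝ → ℂ} (h : Represents T f)
    (h' : Represents T' f) : T = T' := by
  ext ψ
  rw [(h ψ).2, (h' ψ).2]

lemma Represents.congr_ae {T : 𝓢'(ℝ, ℂ)} {f g : ℝ → ℂ} (h : Represents T f)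
    (hfg : f =ᵐ[volume] g) : Represents T g := fun ψ => by
  have hae : (fun x => ψ x * f x) =ᵐ[volume] fun x => ψ x * g x := by
    filter_upwards [hfg] with x hx
    rw [hx]
  exact ⟨(h ψ).1.congr hae, (h ψ).2.trans (integral_congr_ae hae)⟩

lemma Represents.eq_fourierInv {T : 𝓢'(ℝ, ℂ)} {f ρ : ℝ → ℂ} (h : Represents T f)
    (hf : Continuous f) (hT : Represents (𝓕 T) ρ) (hρ : Integrable ρ) : f = 𝓕⁻ ρ := by
  have hinv : Represents T (𝓕⁻ ρ) := by
    rw [← FourierTransform.fourierInv_fourier_eq (F := 𝓢'(ℝ, ℂ)) T,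
      hT.unique (represents_temperedOf hρ)]
    exact represents_fourierInv_temperedOf hρ
  exact (hf.ae_eq_iff_eq volume (continuous_fourierInv hρ)).1 (h.ae_eq hinv)

lemma xNorm_eq (s : ℝ) {u : ℤ → ℝ → ℂ} {T : ℤ → 𝓢'(ℝ, ℂ)} (h : ∀ p, Represents (T p) (u p)) :
    xNorm s u = xDistNorm s T := by
  refine le_antisymm (iInf₂_le T h) (le_iInf₂ fun T' h' => ?_)
  rw [show T = T' from funext fun p => (h p).unique (h' p)]

lemma xDistNorm_eq (s : ℝ) {T : ℤ → 𝓢'(ℝ, ℂ)} {g : ℤ → ℝ → ℂ}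
    (h : ∀ p : ℤ, Odd p → Represents (𝓕 (T p)) (g p)) :
    xDistNorm s T = (∑' p : OddInt, ∫⁻ η : ℝ,
      ENNReal.ofReal ((((p : ℤ) : ℝ) ^ 2 + (2 * Real.pi * η) ^ 2) ^ s)
        * ‖g p η‖ₑ ^ 2) ^ (1 / 2 : ℝ) := by
  refine le_antisymm (iInf₂_le g h) (le_iInf₂ fun g' h' => le_of_eq ?_)
  congr 1
  refine tsum_congr fun p => lintegral_congr_ae ?_
  filter_upwards [(h p p.2).ae_eq (h' p p.2)] with η hη
  rw [hη]

lemma lintegral_modeMeasure {F : ℤ × ℝ → ℝ≥0∞} (hF : AEMeasurable F modeMeasure) :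
    ∫⁻ k, F k ∂modeMeasure = ∑' p : ℤ, ∫⁻ η : ℝ, F (p, η) := by
  rw [lintegral_prod _ hF, lintegral_count]

lemma eLpNorm_sobolev_eq_tsum_odd (s : ℝ) {g : ℤ × ℝ → ℂ} (hg : AEStronglyMeasurable g modeMeasure)
    (heven : ∀ p : ℤ, Even p → ∀ᵐ η : ℝ, g (p, η) = 0) :
    eLpNorm g 2 (modeMeasure.withDensity (sobolevWeight s)) = (∑' p : OddInt, ∫⁻ η : ℝ,
      ENNReal.ofReal ((((p : ℤ) : ℝ) ^ 2 + (2 * Real.pi * η) ^ 2) ^ s)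
        * ‖g (p, η)‖ₑ ^ 2) ^ (1 / 2 : ℝ) := by
  have hw := measurable_sobolevWeight s
  have hsq : eLpNorm g 2 (modeMeasure.withDensity (sobolevWeight s)) ^ 2
      = ∑' p : OddInt, ∫⁻ η : ℝ,
        ENNReal.ofReal ((((p : ℤ) : ℝ) ^ 2 + (2 * Real.pi * η) ^ 2) ^ s) * ‖g (p, η)‖ₑ ^ 2 := by
    rw [eLpNorm_two_withDensity_sq hw hg,
      lintegral_modeMeasure (F := fun k => sobolevWeight s k * ‖g k‖ₑ ^ 2)
        (hw.aemeasurable.mul (hg.enorm.pow_const 2)),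
      ← Subtype.val_injective.tsum_eq (f := fun p : ℤ => ∫⁻ η : ℝ, sobolevWeight s (p, η) *
        ‖g (p, η)‖ₑ ^ 2) (g := ((↑) : OddInt → ℤ))]
    · simp only [sobolevWeight, freqSq_of_odd (Subtype.prop _)]
    · refine fun p hp => ⟨⟨p, Int.not_even_iff_odd.1 fun he => hp ?_⟩, rfl⟩
      exact lintegral_eq_zero_of_ae_eq_zero ((heven p he).mono fun η hη => by simp [hη])
  rw [← hsq, ← ENNReal.rpow_natCast, ← ENNReal.rpow_mul]
  norm_num

lemma xDistNorm_eq_eLpNorm (s : ℝ) {T : ℤ → 𝓢'(ℝ, ℂ)} {g : ℤ × ℝ → ℂ}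
    (hg : AEStronglyMeasurable g modeMeasure)
    (heven : ∀ p : ℤ, Even p → ∀ᵐ η : ℝ, g (p, η) = 0)
    (hT : ∀ p : ℤ, Odd p → Represents (𝓕 (T p)) fun η => g (p, η)) :
    xDistNorm s T = eLpNorm g 2 (modeMeasure.withDensity (sobolevWeight s)) := by
  rw [xDistNorm_eq s hT, eLpNorm_sobolev_eq_tsum_odd s hg heven]

lemma exists_memLp_of_xDistNorm_lt_top {s : ℝ} {T : ℤ → 𝓢'(ℝ, ℂ)} (hT : xDistNorm s T < ⊤) :
    ∃ g : ℤ × ℝ → ℂ, MemLp g 2 (modeMeasure.withDensity (sobolevWeight s)) ∧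
      ∀ p : ℤ, Odd p → Represents (𝓕 (T p)) fun η => g (p, η) := by
  classical
  obtain ⟨g, hg⟩ := iInf_lt_iff.1 hT
  obtain ⟨hgT, -⟩ := iInf_lt_iff.1 hg
  have hm (p : ℤ) (hp : Odd p) : AEStronglyMeasurable (g p) :=
    (locallyIntegrable_of_integrable_schwartz_mul fun ψ =>
      (hgT p hp ψ).1).aestronglyMeasurable
  let γ (k : ℤ × ℝ) : ℂ := if hp : Odd k.1 then (hm k.1 hp).mk (g k.1) k.2 else 0
  have hγm : Measurable γ := measurable_from_prod_countable_right fun p => by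
    by_cases hp : Odd p
    · simpa only [γ, dif_pos hp] using (hm p hp).stronglyMeasurable_mk.measurable
    · simp only [γ, dif_neg hp, measurable_const]
  have hγT (p : ℤ) (hp : Odd p) : Represents (𝓕 (T p)) fun η => γ (p, η) := by
    simpa only [γ, dif_pos hp] using (hgT p hp).congr_ae (hm p hp).ae_eq_mk
  have hγ0 (p : ℤ) (hp : Even p) (η : ℝ) : γ (p, η) = 0 := dif_neg (Int.not_odd_iff_even.2 hp)
  refine ⟨γ, ⟨hγm.aestronglyMeasurable, ?_⟩, hγT⟩
  rwa [← xDistNorm_eq_eLpNorm s hγm.aestronglyMeasurable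
    (fun p hp => .of_forall (hγ0 p hp)) hγT]

section Identification

variable {s : ℝ}

lemma xNorm_modes (hs : 1 < s) {f : SobolevDensity s} (hf : f ∈ reversibleDensity s) :
    xNorm s (modes f) = ‖f‖ₑ := by
  have hi (p : ℤ) : Integrable fun η : ℝ => (f (p, η) : ℂ) :=
    (integrable_slice (integrable_sobolevDensity hs f) p).ofReal
  rw [xNorm_eq s (u := modes f) (T := fun p => 𝓕⁻ (temperedOf (hi p)))
      (fun p => represents_fourierInv_temperedOf (hi p)),
    xDistNorm_eq_eLpNorm s (g := fun k => (f k : ℂ))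
      (integrable_sobolevDensity hs f).ofReal.aestronglyMeasurable, Lp.enorm_def]
  · exact eLpNorm_congr_norm_ae (.of_forall fun k => Complex.norm_real _)
  · intro p hp
    filter_upwards [ae_slice (mem_reversibleDensity_iff.1 hf).2 p] with η hη
    rw [hη hp, Complex.ofReal_zero]
  · intro p _
    rw [FourierTransform.fourier_fourierInv_eq]
    exact represents_temperedOf (hi p)

lemma memX_modes (hs : 1 < s) {f : SobolevDensity s} (hf : f ∈ reversibleDensity s) :
    MemX s (modes f) where
  continuous := continuous_modes (integrable_sobolevDensity hs f)
  norm_lt_top := by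
    rw [xNorm_modes hs hf]
    exact enorm_lt_top
  real := modes_neg_of_mem hf
  even_eq_zero _ hp := modes_eq_zero_of_mem hf hp

lemma isReversible_modes (φ : ℤ × ℝ → ℝ) : IsReversible (modes φ) := fun p _ x => by
  rw [conj_modes, neg_neg]

lemma MemX.exists_memLp {u : ℤ → ℝ → ℂ} (hs : 1 < s) (hu : MemX s u) :
    ∃ g : ℤ × ℝ → ℂ, MemLp g 2 (modeMeasure.withDensity (sobolevWeight s)) ∧
      ∀ p : ℤ, Odd p → u p = 𝓕⁻ fun η => g (p, η) := by
  obtain ⟨T, hT⟩ := iInf_lt_iff.1 hu.norm_lt_top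
  obtain ⟨hTu, hT⟩ := iInf_lt_iff.1 hT
  obtain ⟨g, hg, hgT⟩ := exists_memLp_of_xDistNorm_lt_top hT
  exact ⟨g, hg, fun p hp => (hTu p).eq_fourierInv (hu.continuous p) (hgT p hp)
    (integrable_slice ((isConvolutionWeight_sobolevWeight hs).integrable hg) p)⟩

theorem exists_modes_eq_of_memX (hs : 1 < s) {u : ℤ → ℝ → ℂ} (hu : MemX s u)
    (hrev : IsReversible u) : ∃ f : reversibleDensity s, u = modes (f : SobolevDensity s) := by
  obtain ⟨g, hg, hgu⟩ := hu.exists_memLp hs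
  have hi (p : ℤ) : Integrable fun η => g (p, η) :=
    integrable_slice ((isConvolutionWeight_sobolevWeight hs).integrable hg) p
  have hreal (p : ℤ) (hp : Odd p) : ∀ᵐ η : ℝ, ((g (p, η)).re : ℂ) = g (p, η) := by
    have h := ae_eq_of_fourierInv_eq
      ((LinearIsometryEquiv.integrable_comp_iff Complex.conjLIE).2 (hi p)) (hi p) fun x => by
        rw [← hgu p hp, hrev p hp, hgu p hp, conj_fourierInv, neg_neg]
        rfl
    exact h.mono fun η hη => Complex.conj_eq_iff_re.1 hη
  let f : SobolevDensity s := modeCutoff s {p | Odd p} (hg.re.toLp _)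
  have hf : u = modes f := by
    have hcoe := hg.re.coeFn_toLp
    rw [Filter.EventuallyEq, ae_sobolev_eq] at hcoe
    ext p x
    rw [modes_modeCutoff, modes_congr_ae hcoe]
    by_cases hp : Odd p
    · rw [Set.indicator_of_mem (s := {p | Odd p}) hp, hgu p hp]
      exact Real.fourierInv_congr_ae ((hreal p hp).mono fun η hη => hη.symm) x
    · rw [Set.indicator_of_notMem (s := {p | Odd p}) hp,
        hu.even_eq_zero p (Int.not_odd_iff_even.1 hp)]
  subst hf
  exact ⟨⟨f, mem_reversibleDensity_of_modes hs hu.real hu.even_eq_zero⟩, rfl⟩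

lemma modes_injective (hs : 1 < s) {f g : SobolevDensity s} (h : modes f = modes g) : f = g := by
  rw [Lp.ext_iff, Filter.EventuallyEq, ae_sobolev_eq]
  exact ae_eq_of_modes_eq (integrable_sobolevDensity hs f) (integrable_sobolevDensity hs g)
    fun p x => by rw [h]

end Identification

/-! ### The nonlinear Schrödinger system for densities -/

/-- The symbol `p² + ξ²` of `-(∂_ζ² + ∂_φ²)` on the mode `p`, where `ξ = 2πη`. -/
noncomputable def helmholtz (p : ℤ) (η : ℝ) : ℂ := (p : ℂ) ^ 2 + (2 * Real.pi * η) ^ 2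

lemma hasTemperateGrowth_helmholtz (p : ℤ) : Function.HasTemperateGrowth (helmholtz p) := by
  unfold helmholtz
  have : Function.HasTemperateGrowth fun η : ℝ => (η : ℂ) := Complex.ofRealCLM.hasTemperateGrowth
  fun_prop

lemma helmholtz_of_odd {p : ℤ} (hp : Odd p) (η : ℝ) : helmholtz p η = freqSq (p, η) := by
  rw [freqSq_of_odd hp, helmholtz]
  push_cast
  ring

lemma helmholtz_ne_zero {p : ℤ} (hp : Odd p) (η : ℝ) : helmholtz p η ≠ 0 := by
  rw [helmholtz_of_odd hp]
  exact_mod_cast (freqSq_pos _).ne'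

lemma helmholtz_neg (p : ℤ) (η : ℝ) : helmholtz (-p) (-η) = helmholtz p η := by
  simp [helmholtz]

lemma conj_helmholtz (p : ℤ) (η : ℝ) : conj (helmholtz p η) = helmholtz p η := by
  rw [helmholtz, show ((p : ℂ) ^ 2 + (2 * Real.pi * η) ^ 2)
    = (((p : ℝ) ^ 2 + (2 * Real.pi * η) ^ 2 : ℝ) : ℂ) by push_cast; ring, Complex.conj_ofReal]

lemma schwartz_mul_helmholtz (p : ℤ) (ψ : 𝓢(ℝ, ℂ)) (z : ℂ) (η : ℝ) :
    SchwartzMap.smulLeftCLM ℂ (helmholtz p) ψ η * z = ψ η * (helmholtz p η * z) := by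
  rw [SchwartzMap.smulLeftCLM_apply_apply (hasTemperateGrowth_helmholtz p), smul_eq_mul]
  ring

lemma integrable_schwartz_mul_helmholtz_mul (p : ℤ) (ψ : 𝓢(ℝ, ℂ)) {ρ : ℝ → ℂ}
    (hρ : Integrable ρ) : Integrable fun η => ψ η * (helmholtz p η * ρ η) := by
  simpa only [schwartz_mul_helmholtz] using
    integrable_schwartz_mul (SchwartzMap.smulLeftCLM ℂ (helmholtz p) ψ) hρ

lemma exists_schwartz_helmholtz (p : ℤ) (ψ : 𝓢(ℝ, ℂ)) : ∃ χ : 𝓢(ℝ, ℂ),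
    (∀ ζ, χ ζ = (p : ℂ) ^ 2 * ψ ζ - iteratedDeriv 2 ψ ζ) ∧
      ∀ η, 𝓕⁻ χ η = helmholtz p η * 𝓕⁻ ψ η := by
  refine ⟨(p : ℂ) ^ 2 • ψ + (-1 : ℂ) • SchwartzMap.derivCLM ℂ ℂ (SchwartzMap.derivCLM ℂ ℂ ψ),
    fun ζ => ?_, fun η => ?_⟩
  · simp only [add_apply, smul_apply, smul_eq_mul, iteratedDeriv_two_schwartz]
    ring
  · simp only [FourierTransform.fourierInv_add, FourierTransform.fourierInv_smul, add_apply,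
      smul_apply, fourierInv_derivCLM_derivCLM, helmholtz, smul_eq_mul]
    ring

section Family

variable {s : ℝ} (hs : 1 < s)

lemma integrable_slice_sobolevDensity (hs : 1 < s) (f : SobolevDensity s) (p : ℤ) :
    Integrable fun η : ℝ => (f (p, η) : ℂ) :=
  (integrable_slice (integrable_sobolevDensity hs f) p).ofReal

/-- The distributions `-(∂_ζ² - p²) U_p`, where `U` is the function with Fourier density `f`. -/
noncomputable def helmholtzModes (f : SobolevDensity s) (p : ℤ) : 𝓢'(ℝ, ℂ) :=
  𝓕⁻ (TemperedDistribution.smulLeftCLM ℂ (helmholtz p)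
    (temperedOf (integrable_slice_sobolevDensity hs f p)))

lemma helmholtzModes_apply (f : SobolevDensity s) (p : ℤ) (ψ : 𝓢(ℝ, ℂ)) :
    helmholtzModes hs f p ψ = ∫ η, 𝓕⁻ ψ η * (helmholtz p η * f (p, η)) := by
  rw [helmholtzModes, TemperedDistribution.fourierInv_apply,
    TemperedDistribution.smulLeftCLM_apply_apply, (represents_temperedOf _ _).2]
  simp only [schwartz_mul_helmholtz]

lemma represents_fourier_helmholtzModes (f : SobolevDensity s) (p : ℤ) :
    Represents (𝓕 (helmholtzModes hs f p)) fun η => helmholtz p η * f (p, η) := fun ψ =>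
  ⟨integrable_schwartz_mul_helmholtz_mul p ψ (integrable_slice_sobolevDensity hs f p), by
    simp [TemperedDistribution.fourier_apply, helmholtzModes_apply]⟩

lemma xDistNorm_helmholtzModes {f : SobolevDensity s} (hf : f ∈ reversibleDensity s) :
    xDistNorm (s - 2) (helmholtzModes hs f) = ‖f‖ₑ := by
  have hm : AEStronglyMeasurable (fun k : ℤ × ℝ => helmholtz k.1 k.2 * f k) modeMeasure := by
    refine (Measurable.aestronglyMeasurable ?_).mul
      (integrable_sobolevDensity hs f).ofReal.aestronglyMeasurable
    exact measurable_from_prod_countable_right fun p =>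
      (hasTemperateGrowth_helmholtz p).1.continuous.measurable
  have heven := (mem_reversibleDensity_iff.1 hf).2
  rw [xDistNorm_eq_eLpNorm (s - 2) hm (fun p hp => (ae_slice heven p).mono fun η hη => by
      simp [hη hp]) fun p _ => represents_fourier_helmholtzModes hs f p, Lp.enorm_def]
  refine (ENNReal.pow_right_strictMono two_ne_zero).injective ?_
  rw [eLpNorm_two_withDensity_sq (measurable_sobolevWeight _) hm,
    eLpNorm_two_withDensity_sq (measurable_sobolevWeight _)
      (integrable_sobolevDensity hs f).aestronglyMeasurable]
  refine lintegral_congr_ae ?_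
  filter_upwards [heven] with k hk
  rcases Int.even_or_odd k.1 with hp | hp
  · simp [hk hp]
  · have hpos := freqSq_pos k
    rw [helmholtz_of_odd hp, ← Complex.ofReal_mul, ← ofReal_norm, Complex.norm_real, norm_mul,
      Real.norm_of_nonneg hpos.le, ENNReal.ofReal_mul hpos.le, ofReal_norm, mul_pow, ← mul_assoc,
      sobolevWeight, ← ENNReal.ofReal_pow hpos.le, ← ENNReal.ofReal_mul (by positivity),
      Real.rpow_sub hpos, Real.rpow_two, div_mul_cancel₀ _ (by positivity), sobolevWeight]

lemma fourierInv_schwartz_conj {ψ χ : 𝓢(ℝ, ℂ)} (h : ∀ x, χ x = conj (ψ x)) (η : ℝ) :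
    𝓕⁻ χ η = conj (𝓕⁻ ψ (-η)) := by
  rw [SchwartzMap.fourierInv_coe, SchwartzMap.fourierInv_coe, conj_fourierInv, neg_neg]
  exact congrArg (fun f : ℝ → ℂ => 𝓕⁻ f η) (funext h)

lemma fourierInv_schwartz_conj_neg {ψ χ : 𝓢(ℝ, ℂ)} (h : ∀ x, χ x = conj (ψ (-x))) (η : ℝ) :
    𝓕⁻ χ η = conj (𝓕⁻ ψ η) := by
  rw [SchwartzMap.fourierInv_coe, SchwartzMap.fourierInv_coe, conj_fourierInv,
    show (χ : ℝ → ℂ) = fun x => (fun y => conj (ψ y)) (-x) from funext h,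
    Real.fourierInv_eq_fourier_neg, Real.fourierInv_eq_fourier_comp_neg]

lemma memXDist_helmholtzModes {f : SobolevDensity s} (hf : f ∈ reversibleDensity s) :
    MemXDist (s - 2) (helmholtzModes hs f) where
  norm_lt_top := by
    rw [xDistNorm_helmholtzModes hs hf]
    exact enorm_lt_top
  real p ψ χ hχ := by
    rw [helmholtzModes_apply, helmholtzModes_apply, ← integral_conj, ← integral_neg_eq_self]
    refine integral_congr_ae ?_
    filter_upwards [ae_slice (mem_reversibleDensity_iff.1 hf).1 p] with η hη
    rw [Prod.neg_mk] at hη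
    simp [fourierInv_schwartz_conj hχ, helmholtz_neg, conj_helmholtz, hη]
  even_eq_zero p hp := by
    ext ψ
    rw [helmholtzModes_apply]
    refine integral_eq_zero_of_ae ?_
    filter_upwards [ae_slice (mem_reversibleDensity_iff.1 hf).2 p] with η hη
    simp [hη hp]

lemma isReversibleDist_helmholtzModes (f : SobolevDensity s) :
    IsReversibleDist (helmholtzModes hs f) := fun p _ ψ χ hχ => by
  rw [helmholtzModes_apply, helmholtzModes_apply, ← integral_conj]
  simp only [fourierInv_schwartz_conj_neg hχ, map_mul, conj_helmholtz, Complex.conj_ofReal]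

lemma reversibleDensity_ext_odd_iff {f g : reversibleDensity s} : f = g ↔
    ∀ p : ℤ, Odd p → ∀ᵐ η : ℝ, (f : SobolevDensity s) (p, η) = (g : SobolevDensity s) (p, η) := by
  refine ⟨fun h p _ => .of_forall fun η => by rw [h], fun h => Subtype.ext ?_⟩
  rw [Lp.ext_iff, Filter.EventuallyEq, ae_sobolev_eq]
  refine ae_of_slice fun p => ?_
  rcases Int.even_or_odd p with hp | hp
  · filter_upwards [ae_slice (mem_reversibleDensity_iff.1 f.2).2 p,
      ae_slice (mem_reversibleDensity_iff.1 g.2).2 p] with η hf hg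
    rw [hf hp, hg hp]
  · exact h p hp

lemma helmholtzModes_injective {f g : reversibleDensity s}
    (h : ∀ p : ℤ, Odd p → helmholtzModes hs (f : SobolevDensity s) p = helmholtzModes hs g p) :
    f = g := by
  refine reversibleDensity_ext_odd_iff.2 fun p hp => ?_
  have hrep := represents_fourier_helmholtzModes hs (f : SobolevDensity s) p
  rw [h p hp] at hrep
  filter_upwards [hrep.ae_eq (represents_fourier_helmholtzModes hs g p)] with η hη
  exact_mod_cast mul_left_cancel₀ (helmholtz_ne_zero hp η) hη

end Family

section Schrodinger

variable {s : ℝ} (hs : 1 < s)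

lemma ae_slice_of_sobolev {P : ℤ × ℝ → Prop}
    (h : ∀ᵐ k ∂modeMeasure.withDensity (sobolevWeight s), P k) (p : ℤ) : ∀ᵐ η : ℝ, P (p, η) :=
  ae_slice (by rwa [ae_sobolev_eq] at h) p

theorem eq_smul_filteredCubic_of_isNLSSolution {Γ : ℝ} {w : reversibleDensity s}
    (hw : IsNLSSolution Γ (modes (w : SobolevDensity s))) :
    w = (2 * (Γ / 3)) • filteredCubic hs isReversibleSymbol_angularSymbol (w, w) := by
  refine reversibleDensity_ext_odd_iff.2 fun p hp => ?_
  set N := cubicDensity hs (w : SobolevDensity s) w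
  let c : ℝ := -(2 * (p : ℝ) ^ 2 / 3 * Γ)
  have hwi := (integrable_sobolevDensity hs (w : SobolevDensity s)).const_mul ((p : ℝ) ^ 2)
  have hNi := (integrable_sobolevDensity hs N).const_mul c
  have hae := ae_eq_of_iteratedDeriv_two_fourierInv
    (integrable_slice_sobolevDensity hs (w : SobolevDensity s) p)
    (integrable_slice (hwi.add hNi) p).ofReal (hw.contDiff p hp) fun x => by
      change iteratedDeriv 2 (modes (w : SobolevDensity s) p) x
        = modes (fun k => (p : ℝ) ^ 2 * (w : SobolevDensity s) k + c * N k) p x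
      have heqn := hw.eqn p hp x
      rw [← modes_cubicDensity hs w.2 w.2] at heqn
      rw [modes_add hwi hNi, modes_const_mul, modes_const_mul]
      push_cast [c]
      linear_combination heqn
  filter_upwards [hae, ae_slice_of_sobolev (Lp.coeFn_smul (2 * (Γ / 3))
      (filteredCubic hs isReversibleSymbol_angularSymbol (w, w) : SobolevDensity s)) p,
    ae_slice (coeFn_filteredCubic hs isReversibleSymbol_angularSymbol (w, w)) p] with η h₁ h₂ h₃
  have h₁' : -(2 * Real.pi * η) ^ 2 * (w : SobolevDensity s) (p, η)
      = (p : ℝ) ^ 2 * (w : SobolevDensity s) (p, η) + c * N (p, η) := by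
    exact Complex.ofReal_injective (by simpa using h₁)
  have hpos := freqSq_pos (p, η)
  rw [Submodule.coe_smul, h₂, Pi.smul_apply, h₃, angularSymbol, smul_eq_mul]
  field_simp
  rw [freqSq_of_odd hp]
  linear_combination -3 * h₁'

lemma integral_linearized_modes (Γ : ℝ) (u w : reversibleDensity s) (p : ℤ) (ψ : 𝓢(ℝ, ℂ)) :
    ∫ ζ : ℝ, (modes (w : SobolevDensity s) p ζ
        * (iteratedDeriv 2 (fun x => ψ x) ζ - (p : ℂ) ^ 2 * ψ ζ)
      + 2 * (p : ℂ) ^ 2 / 3 * Γ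
        * cubicDeriv (modes (u : SobolevDensity s)) (modes (w : SobolevDensity s)) p ζ * ψ ζ)
    = ∫ η, 𝓕⁻ ψ η * (2 * (p : ℂ) ^ 2 / 3 * Γ * cubicDensityDeriv hs (u : SobolevDensity s) w (p, η)
      - helmholtz p η * (w : SobolevDensity s) (p, η)) := by
  have hw := integrable_slice_sobolevDensity hs (w : SobolevDensity s) p
  have hD := integrable_slice_sobolevDensity hs (cubicDensityDeriv hs (u : SobolevDensity s) w) p
  obtain ⟨χ, hχ, hχ'⟩ := exists_schwartz_helmholtz p ψ
  set c : ℂ := 2 * (p : ℂ) ^ 2 / 3 * Γ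
  calc
    _ = ∫ ζ, (c * (ψ ζ * modes (cubicDensityDeriv hs (u : SobolevDensity s) w) p ζ)
          - χ ζ * modes (w : SobolevDensity s) p ζ) := by
      refine integral_congr_ae (.of_forall fun ζ => ?_)
      simp only [hχ, modes_cubicDensityDeriv hs u.2 w.2]
      ring
    _ = c * (∫ η, 𝓕⁻ ψ η * cubicDensityDeriv hs (u : SobolevDensity s) w (p, η))
          - ∫ η, 𝓕⁻ χ η * (w : SobolevDensity s) (p, η) := by
      rw [← integral_schwartz_mul_fourierInv ψ hD, ← integral_schwartz_mul_fourierInv χ hw,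
        ← integral_const_mul]
      exact integral_sub ((integrable_schwartz_mul_fourierInv ψ hD).const_mul c)
        (integrable_schwartz_mul_fourierInv χ hw)
    _ = _ := by
      rw [← integral_const_mul, ← integral_sub ((integrable_schwartz_mul _ hD).const_mul c)
        (integrable_schwartz_mul _ hw)]
      refine integral_congr_ae (.of_forall fun η => ?_)
      simp only [hχ']
      ring

theorem isLinearizedImage_modes (Γ : ℝ) (u w : reversibleDensity s) :
    IsLinearizedImage Γ (modes (u : SobolevDensity s)) (modes (w : SobolevDensity s))
      (helmholtzModes hs
        (((2 * (Γ / 3)) • filteredCubicDeriv hs isReversibleSymbol_angularSymbol u) w - w :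
          reversibleDensity s)) := by
  intro p hp ψ
  rw [helmholtzModes_apply, integral_linearized_modes hs]
  refine integral_congr_ae ?_
  set D := filteredCubicDeriv hs isReversibleSymbol_angularSymbol u w with hD
  filter_upwards [ae_slice_of_sobolev (Lp.coeFn_sub (((2 * (Γ / 3)) • D : reversibleDensity s)
      : SobolevDensity s) w) p,
    ae_slice_of_sobolev (Lp.coeFn_smul (2 * (Γ / 3)) (D : SobolevDensity s)) p,
    ae_slice (coeFn_filteredCubicDeriv hs isReversibleSymbol_angularSymbol u w) p] with η h₁ h₂ h₃
  have hpos : (freqSq (p, η) : ℂ) ≠ 0 := by exact_mod_cast (freqSq_pos (p, η)).ne'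
  rw [smul_apply, ← hD, Submodule.coe_sub, h₁, Pi.sub_apply,
    Submodule.coe_smul, h₂, Pi.smul_apply, h₃, angularSymbol, smul_eq_mul,
    helmholtz_of_odd hp]
  push_cast
  field_simp

theorem bijective_sub_filteredCubicDeriv {Γ : ℝ} {u : reversibleDensity s}
    (hinv : LinearizationInvertible s Γ (modes (u : SobolevDensity s))) :
    Function.Bijective fun h : reversibleDensity s => h - ((2 * (Γ / 3)) •
      filteredCubicDeriv hs isReversibleSymbol_angularSymbol u) h := by
  set K := (2 * (Γ / 3)) • filteredCubicDeriv hs isReversibleSymbol_angularSymbol u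
  have hex (h : reversibleDensity s) := hinv.bijective (helmholtzModes hs h)
    (memXDist_helmholtzModes hs h.2) (isReversibleDist_helmholtzModes hs _)
  have himage (w : reversibleDensity s) : IsLinearizedImage Γ (modes (u : SobolevDensity s))
    (modes (w : SobolevDensity s)) (helmholtzModes hs (K w - w : reversibleDensity s)) :=
    isLinearizedImage_modes hs Γ u w
  constructor
  · intro w w' hww
    have hww' : K w' - w' = K w - w := by
      rw [← neg_sub, ← neg_sub (w : reversibleDensity s)]
      exact congrArg Neg.neg hww.symm
    refine Subtype.ext (modes_injective hs ((hex (K w - w)).unique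
      ⟨memX_modes hs w.2, isReversible_modes _, himage w⟩
      ⟨memX_modes hs w'.2, isReversible_modes _, hww' ▸ himage w'⟩))
  · intro h
    obtain ⟨W, ⟨hW, hrev, hWh⟩, -⟩ := hex (-h)
    obtain ⟨w, rfl⟩ := exists_modes_eq_of_memX hs hW hrev
    refine ⟨w, ?_⟩
    have hKw : K w - w = -h := helmholtzModes_injective hs fun p hp => by
      ext ψ
      exact (himage w p hp ψ).trans (hWh p hp ψ).symm
    dsimp only
    rw [← neg_sub, hKw, neg_neg]

end Schrodinger

/-! ### The coupled mode system for densities -/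

lemma hasDerivAt_comp_mul_left_iff {E : Type*} [NormedAddCommGroup E] [NormedSpace ℝ E]
    {f g : ℝ → E} {c : ℝ} (hc : c ≠ 0) :
    (∀ x, HasDerivAt (fun y => f (c * y)) (g (c * x)) x) ↔ ∀ x, HasDerivAt f (c⁻¹ • g x) x := by
  constructor
  · intro h x
    have hx := h (c⁻¹ * x)
    rw [mul_inv_cancel_left₀ hc] at hx
    simpa [Function.comp_def, mul_inv_cancel_left₀ hc] using
      hx.scomp (h := fun y => c⁻¹ * y) x ((hasDerivAt_id x).const_mul c⁻¹)
  · intro h x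
    simpa [Function.comp_def, smul_smul, hc] using
      (h (c * x)).scomp (h := fun y => c * y) x ((hasDerivAt_id x).const_mul c)

lemma fourierInv_const_mul (c : ℂ) (ρ : ℝ → ℂ) (x : ℝ) :
    𝓕⁻ (fun η => c * ρ η) x = c * 𝓕⁻ ρ x := by
  simp only [Real.fourierInv_eq, ← integral_const_mul, Circle.smul_def, smul_eq_mul]
  exact integral_congr_ae (.of_forall fun η => mul_left_comm _ _ _)

lemma hasDerivAt_fourierInv_iff {ρ σ : ℝ → ℂ} (hρ : Integrable ρ) (hσ : Integrable σ) :
    (∀ x, HasDerivAt (𝓕⁻ ρ) (𝓕⁻ σ x) x) ↔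
      (fun η : ℝ => 2 * Real.pi * Complex.I * η * ρ η) =ᵐ[volume] σ := by
  refine ⟨ae_eq_of_hasDerivAt_fourierInv hρ hσ, fun h x => ?_⟩
  have hρ' : Integrable fun η : ℝ => (η : ℂ) * ρ η := by
    refine ((hσ.congr h.symm).const_mul (2 * Real.pi * Complex.I)⁻¹).congr (.of_forall fun η => ?_)
    have := Complex.two_pi_I_ne_zero
    field_simp
  rw [← Real.fourierInv_congr_ae h]
  exact hasDerivAt_fourierInv hρ hρ' x

lemma hasDerivAt_modes_iff {φ σ : ℤ × ℝ → ℝ} (hφ : Integrable φ modeMeasure)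
    (hσ : Integrable σ modeMeasure) (p : ℤ) :
    (∀ x, HasDerivAt (modes φ p) (Complex.I * modes σ p x) x) ↔
      ∀ᵐ η : ℝ, 2 * Real.pi * η * φ (p, η) = σ (p, η) := by
  simp only [modes, ← fourierInv_const_mul]
  refine (hasDerivAt_fourierInv_iff (integrable_slice hφ p).ofReal
    ((integrable_slice hσ p).ofReal.const_mul Complex.I)).trans
    (Filter.eventually_congr (.of_forall fun η => ?_))
  have h : 2 * Real.pi * Complex.I * η * (φ (p, η) : ℂ)
      = Complex.I * (2 * Real.pi * η * φ (p, η) : ℝ) := by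
    push_cast
    ring
  change 2 * Real.pi * Complex.I * η * (φ (p, η) : ℂ) = Complex.I * (σ (p, η) : ℂ) ↔ _
  rw [h, mul_right_inj' Complex.I_ne_zero, Complex.ofReal_inj]

lemma isCoupledModeSolution_iff_hasDerivAt {Γ Ω : ℝ} {A B : ℤ → ℝ → ℂ} :
    IsCoupledModeSolution Γ Ω A B ↔ ∀ p : ℤ, Odd p →
      (∀ Z, HasDerivAt (A p)
        (Complex.I * (p * (Ω * A p Z + B p Z + Γ / 3 * cubic A B p Z))) Z) ∧
      ∀ Z, HasDerivAt (B p)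
        (-(Complex.I * (p * (Ω * B p Z + A p Z + Γ / 3 * cubic B A p Z)))) Z := by
  constructor
  · refine fun h p hp => ⟨fun Z => ?_, fun Z => ?_⟩
    · refine (h.differentiable_left p hp Z).hasDerivAt.congr_deriv ?_
      linear_combination -Complex.I * h.left p hp Z + deriv (A p) Z * Complex.I_sq
    · refine (h.differentiable_right p hp Z).hasDerivAt.congr_deriv ?_
      linear_combination Complex.I * h.right p hp Z + deriv (B p) Z * Complex.I_sq
  · refine fun h => ⟨fun p hp Z => ((h p hp).1 Z).differentiableAt,
      fun p hp Z => ((h p hp).2 Z).differentiableAt, fun p hp Z => ?_, fun p hp Z => ?_⟩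
    · rw [((h p hp).1 Z).deriv]
      linear_combination p * (Ω * A p Z + B p Z + Γ / 3 * cubic A B p Z) * Complex.I_sq
    · rw [((h p hp).2 Z).deriv]
      linear_combination p * (Ω * B p Z + A p Z + Γ / 3 * cubic B A p Z) * Complex.I_sq

section CoupledModes

variable {s : ℝ} (hs : 1 < s)

/-- The density of `Ω A + B + (Γ/3) cubic A B`, where `A` and `B` have the densities `f` and `g`:
the coupled mode system reads `i A_p' + p (…)_p = 0`, `-i B_p' + p (…)_p = 0`. -/
noncomputable def couplingDensity (Γ Ω : ℝ) (f g : SobolevDensity s) (k : ℤ × ℝ) : ℝ :=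
  Ω * f k + g k + Γ / 3 * cubicDensity hs f g k

lemma integrable_couplingDensity (Γ Ω : ℝ) (f g : SobolevDensity s) :
    Integrable (couplingDensity hs Γ Ω f g) modeMeasure :=
  (((integrable_sobolevDensity hs f).const_mul Ω).add (integrable_sobolevDensity hs g)).add
    ((integrable_sobolevDensity hs _).const_mul (Γ / 3))

lemma modes_couplingDensity (Γ Ω : ℝ) {f g : SobolevDensity s} (hf : f ∈ reversibleDensity s)
    (hg : g ∈ reversibleDensity s) (p : ℤ) (x : ℝ) :
    modes (couplingDensity hs Γ Ω f g) p x
      = Ω * modes f p x + modes g p x + Γ / 3 * cubic (modes f) (modes g) p x := by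
  have hΩf := (integrable_sobolevDensity hs f).const_mul Ω
  have hg' := integrable_sobolevDensity hs g
  have hN := (integrable_sobolevDensity hs (cubicDensity hs f g)).const_mul (Γ / 3)
  unfold couplingDensity
  rw [modes_add (φ := fun k => Ω * f k + g k) (hΩf.add hg') hN, modes_add hΩf hg',
    modes_const_mul, modes_const_mul, modes_cubicDensity hs hf hg]
  push_cast
  rfl

lemma hasDerivAt_modes_comp_mul_iff {μ : ℝ} (hμ : μ ≠ 0) {φ σ : ℤ × ℝ → ℝ}
    (hφ : Integrable φ modeMeasure) (hσ : Integrable σ modeMeasure) (p : ℤ) (c : ℝ) :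
    (∀ Z, HasDerivAt (fun y => modes φ p (μ * y)) (Complex.I * (c * modes σ p (μ * Z))) Z) ↔
      ∀ᵐ η : ℝ, μ * (2 * Real.pi * η) * φ (p, η) = c * σ (p, η) := by
  have h := hasDerivAt_modes_iff hφ (hσ.const_mul (μ⁻¹ * c)) p
  simp only [modes_const_mul] at h
  refine (hasDerivAt_comp_mul_left_iff (g := fun x => Complex.I * (c * modes σ p x)) hμ).trans
    (Iff.trans (forall_congr' fun x => ?_) (h.trans
      (Filter.eventually_congr (.of_forall fun η => ?_))))
  · rw [Complex.real_smul, mul_left_comm, Complex.ofReal_mul, mul_assoc]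
  · rw [mul_assoc μ⁻¹, eq_inv_mul_iff_mul_eq₀ hμ, ← mul_assoc]

lemma isCoupledModeSolution_modes_iff (Γ Ω : ℝ) {μ : ℝ} (hμ : μ ≠ 0)
    (f g : reversibleDensity s) :
    IsCoupledModeSolution Γ Ω (fun p Z => modes (f : SobolevDensity s) p (μ * Z))
      (fun p Z => modes (g : SobolevDensity s) p (μ * Z)) ↔
    ∀ p : ℤ, Odd p →
      (∀ᵐ η : ℝ, μ * (2 * Real.pi * η) * (f : SobolevDensity s) (p, η)
        = p * couplingDensity hs Γ Ω (f : SobolevDensity s) g (p, η)) ∧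
      ∀ᵐ η : ℝ, μ * (2 * Real.pi * η) * (g : SobolevDensity s) (p, η)
        = -p * couplingDensity hs Γ Ω (g : SobolevDensity s) f (p, η) := by
  rw [isCoupledModeSolution_iff_hasDerivAt]
  refine forall₂_congr fun p _ => and_congr ?_ ?_
  · rw [← hasDerivAt_modes_comp_mul_iff hμ (integrable_sobolevDensity hs _)
      (integrable_couplingDensity hs Γ Ω _ _)]
    simp only [modes_couplingDensity hs Γ Ω f.2 g.2]
    rfl
  · rw [← hasDerivAt_modes_comp_mul_iff hμ (integrable_sobolevDensity hs _)
      (integrable_couplingDensity hs Γ Ω _ _)]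
    simp only [modes_couplingDensity hs Γ Ω g.2 f.2, Complex.ofReal_neg, neg_mul, mul_neg]
    rfl

end CoupledModes

/-! ### Reduction of the coupled mode system to the branch equation -/

-- The linear part of the system on the left has determinant `-μ² (p² + ξ²)`; the system on the
-- right arises by applying the adjugate matrix.
lemma mode_system_iff {p ξ μ Ω γ a b n₁ n₂ : ℝ} (hF : p ^ 2 + ξ ^ 2 ≠ 0)
    (hμ : μ ≠ 0) (hΩ : Ω ^ 2 = 1 - μ ^ 2) :
    (μ * ξ * a = p * (Ω * a + b + γ * n₁) ∧ μ * ξ * b = -p * (Ω * b + a + γ * n₂)) ↔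
      ((p ^ 2 + ξ ^ 2) * (μ ^ 2 * a) = γ * (Ω * (p ^ 2 * n₁) + μ * (p * ξ * n₁) - p ^ 2 * n₂) ∧
        (p ^ 2 + ξ ^ 2) * (μ ^ 2 * b)
          = γ * (Ω * (p ^ 2 * n₂) + -μ * (p * ξ * n₂) - p ^ 2 * n₁)) := by
  constructor
  · rintro ⟨h₁, h₂⟩
    constructor
    · linear_combination (p * Ω + μ * ξ) * h₁ + p * h₂ + p ^ 2 * a * hΩ
    · linear_combination -(p * Ω - μ * ξ) * h₂ - p * h₁ + p ^ 2 * b * hΩ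
  · rintro ⟨h₁, h₂⟩
    have hdet : μ ^ 2 * (p ^ 2 + ξ ^ 2) ≠ 0 := mul_ne_zero (pow_ne_zero 2 hμ) hF
    constructor
    · refine mul_left_cancel₀ hdet ?_
      linear_combination -(p * Ω - μ * ξ) * h₁ - p * h₂ - γ * p ^ 3 * n₁ * hΩ
    · refine mul_left_cancel₀ hdet ?_
      linear_combination p * h₁ + (p * Ω + μ * ξ) * h₂ + γ * p ^ 3 * n₂ * hΩ

section Reduction

variable {s : ℝ} (hs : 1 < s)

/-- The cubic part of the first equation of the coupled mode system with frequency `Ω` and slow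
variable `ζ = μ Z`, once the linear part has been inverted. Exchanging `f` with `g` and changing
the sign of `μ` gives the second equation. -/
noncomputable def resolvedCubic (Ω μ : ℝ) (f g : reversibleDensity s) : reversibleDensity s :=
  Ω • filteredCubic hs isReversibleSymbol_angularSymbol (f, g)
    + μ • filteredCubic hs isReversibleSymbol_mixedSymbol (f, g)
    - filteredCubic hs isReversibleSymbol_angularSymbol (g, f)

lemma ae_slice_resolvedCubic (Ω μ : ℝ) (f g : reversibleDensity s) (p : ℤ) :
    ∀ᵐ η : ℝ, (resolvedCubic hs Ω μ f g : SobolevDensity s) (p, η)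
      = Ω * (angularSymbol (p, η) * cubicDensity hs (f : SobolevDensity s) g (p, η))
        + μ * (mixedSymbol (p, η) * cubicDensity hs (f : SobolevDensity s) g (p, η))
        - angularSymbol (p, η) * cubicDensity hs (g : SobolevDensity s) f (p, η) := by
  let P := filteredCubic hs isReversibleSymbol_angularSymbol
  let Q := filteredCubic hs isReversibleSymbol_mixedSymbol
  have hsub := Lp.coeFn_sub (Ω • (P (f, g) : SobolevDensity s) + μ • (Q (f, g) : SobolevDensity s))
    (P (g, f) : SobolevDensity s)
  have hadd := Lp.coeFn_add (Ω • (P (f, g) : SobolevDensity s)) (μ • (Q (f, g) : SobolevDensity s))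
  filter_upwards [ae_slice_of_sobolev hsub p, ae_slice_of_sobolev hadd p,
    ae_slice_of_sobolev (Lp.coeFn_smul Ω (P (f, g) : SobolevDensity s)) p,
    ae_slice_of_sobolev (Lp.coeFn_smul μ (Q (f, g) : SobolevDensity s)) p,
    ae_slice (coeFn_filteredCubic hs isReversibleSymbol_angularSymbol (f, g)) p,
    ae_slice (coeFn_filteredCubic hs isReversibleSymbol_mixedSymbol (f, g)) p,
    ae_slice (coeFn_filteredCubic hs isReversibleSymbol_angularSymbol (g, f)) p]
    with η h₁ h₂ h₃ h₄ h₅ h₆ h₇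
  simp only [resolvedCubic, Submodule.coe_sub, Submodule.coe_add, Submodule.coe_smul]
  rw [h₁, Pi.sub_apply, h₂, Pi.add_apply, h₃, h₄, Pi.smul_apply, Pi.smul_apply, h₅, h₆, h₇]
  simp only [smul_eq_mul]

lemma sq_smul_eq_smul_resolvedCubic_iff (γ Ω μ ν : ℝ) (f g : reversibleDensity s) :
    μ ^ 2 • f = γ • resolvedCubic hs Ω ν f g ↔ ∀ p : ℤ, Odd p → ∀ᵐ η : ℝ,
      ((p : ℝ) ^ 2 + (2 * Real.pi * η) ^ 2) * (μ ^ 2 * (f : SobolevDensity s) (p, η))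
        = γ * (Ω * (p ^ 2 * cubicDensity hs (f : SobolevDensity s) g (p, η))
          + ν * (p * (2 * Real.pi * η) * cubicDensity hs (f : SobolevDensity s) g (p, η))
          - p ^ 2 * cubicDensity hs (g : SobolevDensity s) f (p, η)) := by
  rw [reversibleDensity_ext_odd_iff]
  refine forall₂_congr fun p hp => Filter.eventually_congr ?_
  filter_upwards [ae_slice_of_sobolev (Lp.coeFn_smul (μ ^ 2) (f : SobolevDensity s)) p,
    ae_slice_of_sobolev (Lp.coeFn_smul γ (resolvedCubic hs Ω ν f g : SobolevDensity s)) p,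
    ae_slice_resolvedCubic hs Ω ν f g p] with η h₁ h₂ h₃
  have hpos := freqSq_pos (p, η)
  rw [Submodule.coe_smul, Submodule.coe_smul, h₁, h₂, Pi.smul_apply, Pi.smul_apply, h₃,
    angularSymbol, mixedSymbol, smul_eq_mul, smul_eq_mul, ← freqSq_of_odd hp]
  field_simp

theorem isCoupledModeSolution_iff_resolvedCubic (Γ : ℝ) {Ω μ : ℝ} (hμ : μ ≠ 0)
    (hΩ : Ω ^ 2 = 1 - μ ^ 2) (f g : reversibleDensity s) :
    IsCoupledModeSolution Γ Ω (fun p Z => modes (f : SobolevDensity s) p (μ * Z))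
      (fun p Z => modes (g : SobolevDensity s) p (μ * Z)) ↔
    μ ^ 2 • f = (Γ / 3) • resolvedCubic hs Ω μ f g ∧
      μ ^ 2 • g = (Γ / 3) • resolvedCubic hs Ω (-μ) g f := by
  rw [isCoupledModeSolution_modes_iff hs Γ Ω hμ, sq_smul_eq_smul_resolvedCubic_iff,
    sq_smul_eq_smul_resolvedCubic_iff, ← forall₂_and]
  refine forall₂_congr fun p hp => ?_
  rw [← Filter.eventually_and, ← Filter.eventually_and]
  refine Filter.eventually_congr (.of_forall fun η => mode_system_iff ?_ hμ hΩ)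
  rw [← freqSq_of_odd hp]
  exact (freqSq_pos _).ne'

theorem isCoupledModeSolution_iff_slowDefect (Γ : ℝ) {μ : ℝ} (hμ : μ ≠ 0) (hμ₁ : |μ| ≤ 1)
    (x : reversibleDensity s × reversibleDensity s) :
    IsCoupledModeSolution Γ √(1 - μ ^ 2)
      (fun p Z => modes ((μ • x.1 : reversibleDensity s) : SobolevDensity s) p (μ * Z))
      (fun p Z => modes ((-μ • x.2 : reversibleDensity s) : SobolevDensity s) p (μ * Z)) ↔
    slowDefect (filteredCubic hs isReversibleSymbol_angularSymbol)
      (filteredCubic hs isReversibleSymbol_mixedSymbol) (Γ / 3) μ x = 0 := by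
  have hΩ : √(1 - μ ^ 2) ^ 2 = 1 - μ ^ 2 :=
    Real.sq_sqrt (sub_nonneg.2 ((sq_le_one_iff_abs_le_one μ).2 hμ₁))
  obtain ⟨a, b⟩ := x
  have hneg : (-μ) ^ 2 = μ ^ 2 := neg_sq μ
  rw [isCoupledModeSolution_iff_resolvedCubic hs Γ hμ hΩ, slowDefect, Prod.mk_eq_zero,
    sub_eq_zero, sub_eq_zero]
  simp only [resolvedCubic, filteredCubic_smul_smul hs _ hneg, Prod.swap,
    filteredCubic_smul_smul hs _ hneg.symm]
  refine and_congr ?_ ?_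
  · rw [← (smul_right_injective _ (pow_ne_zero 3 hμ)).eq_iff (a := a)]
    refine Eq.congr ?_ ?_ <;> module
  · rw [← (smul_right_injective _ (pow_ne_zero 3 (neg_ne_zero.2 hμ))).eq_iff (a := b)]
    refine Eq.congr ?_ ?_ <;> module

end Reduction

/-! ### Dilations -/

lemma map_dilate_modeMeasure {c : ℝ} (hc : c ≠ 0) :
    modeMeasure.map (Prod.map id (c * ·)) = ENNReal.ofReal |c⁻¹| • modeMeasure := by
  rw [modeMeasure, ← Measure.map_prod_map _ _ measurable_id (measurable_const_mul c),
    Measure.map_id, Real.map_volume_mul_left hc, Measure.prod_smul_right]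

lemma sobolevWeight_le_dilate {s : ℝ} (hs : 0 ≤ s) {c : ℝ} (hc : 1 ≤ |c|) (k : ℤ × ℝ) :
    sobolevWeight s k ≤ sobolevWeight s (Prod.map id (c * ·) k) := by
  refine ENNReal.ofReal_le_ofReal (Real.rpow_le_rpow (freqSq_pos k).le ?_ hs)
  have hsq : (2 * Real.pi * k.2) ^ 2 ≤ (2 * Real.pi * (c * k.2)) ^ 2 := by
    rw [mul_left_comm, mul_pow c]
    exact le_mul_of_one_le_left (sq_nonneg _) ((one_le_sq_iff_one_le_abs c).2 hc)
  exact add_le_add_right hsq _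

lemma map_dilate_sobolev_le {s : ℝ} (hs : 0 ≤ s) {c : ℝ} (hc : 1 ≤ |c|) :
    (modeMeasure.withDensity (sobolevWeight s)).map (Prod.map id (c * ·))
      ≤ ENNReal.ofReal |c⁻¹| • modeMeasure.withDensity (sobolevWeight s) := by
  have hc₀ : c ≠ 0 := abs_pos.1 (zero_lt_one.trans_le hc)
  have hD : Measurable (Prod.map id (c * ·) : ℤ × ℝ → ℤ × ℝ) :=
    measurable_id.prodMap (measurable_const_mul c)
  refine Measure.le_iff.2 fun S hS => ?_
  calc (modeMeasure.withDensity (sobolevWeight s)).map (Prod.map id (c * ·)) S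
      = ∫⁻ k in Prod.map id (c * ·) ⁻¹' S, sobolevWeight s k ∂modeMeasure := by
        rw [Measure.map_apply hD hS, withDensity_apply _ (hD hS)]
    _ ≤ ∫⁻ k in Prod.map id (c * ·) ⁻¹' S,
          sobolevWeight s (Prod.map id (c * ·) k) ∂modeMeasure :=
        lintegral_mono fun k => sobolevWeight_le_dilate hs hc k
    _ = (ENNReal.ofReal |c⁻¹| • modeMeasure.withDensity (sobolevWeight s)) S := by
        rw [← setLIntegral_map hS (measurable_sobolevWeight s) hD, map_dilate_modeMeasure hc₀,
          Measure.restrict_smul, lintegral_smul_measure, Measure.smul_apply,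
          withDensity_apply _ hS]

lemma modes_dilate {μ : ℝ} (hμ : μ ≠ 0) (φ : ℤ × ℝ → ℝ) (p : ℤ) (x : ℝ) :
    modes (fun k => |μ|⁻¹ * φ (Prod.map id (μ⁻¹ * ·) k)) p x = modes φ p (μ * x) := by
  have h := Measure.integral_comp_mul_left
    (fun η : ℝ => (Real.fourierChar (η * (μ * x)) : ℂ) * φ (p, η)) μ⁻¹
  have harg (η : ℝ) : μ⁻¹ * η * (μ * x) = η * x := by field_simp
  simp only [harg, inv_inv] at h
  rw [modes_const_mul, modes_eq, modes_eq]
  simp only [Prod.map_apply, id_eq]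
  rw [h, Complex.real_smul, ← mul_assoc,
    ← Complex.ofReal_mul, inv_mul_cancel₀ (abs_ne_zero.2 hμ), Complex.ofReal_one, one_mul]

lemma memX_modes_comp_mul {s : ℝ} (hs : 1 < s) {f : SobolevDensity s}
    (hf : f ∈ reversibleDensity s) {μ : ℝ} (hμ : μ ≠ 0) (hμ₁ : |μ| ≤ 1) :
    MemX s fun p Z => modes f p (μ * Z) := by
  have hμ' : 1 ≤ |μ⁻¹| := by
    rw [abs_inv]
    exact (one_le_inv₀ (abs_pos.2 hμ)).2 hμ₁
  have hdil : MemLp (fun k => |μ|⁻¹ * f (Prod.map id (μ⁻¹ * ·) k)) 2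
      (modeMeasure.withDensity (sobolevWeight s)) :=
    (((Lp.memLp f).of_measure_le_smul ENNReal.ofReal_ne_top
      (map_dilate_sobolev_le (zero_le_one.trans hs.le) hμ')).comp_of_map
        (measurable_id.prodMap (measurable_const_mul μ⁻¹)).aemeasurable).const_mul |μ|⁻¹
  have hmodes (p : ℤ) (Z : ℝ) : modes (hdil.toLp _ : SobolevDensity s) p Z = modes f p (μ * Z) := by
    have hcoe := hdil.coeFn_toLp
    rw [Filter.EventuallyEq, ae_sobolev_eq] at hcoe
    rw [modes_congr_ae hcoe, modes_dilate hμ]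
  simp only [← hmodes]
  refine memX_modes hs (mem_reversibleDensity_of_modes hs (fun p Z => ?_) fun p hp Z => ?_)
  · rw [hmodes, hmodes, modes_neg_of_mem hf]
  · rw [hmodes, modes_eq_zero_of_mem hf hp]

lemma isReversible_modes_comp_mul (φ : ℤ × ℝ → ℝ) (μ : ℝ) :
    IsReversible fun p Z => modes φ p (μ * Z) := fun p hp Z => by
  simpa only [mul_neg] using isReversible_modes φ p hp (μ * Z)

lemma IsReversible.of_comp_mul {μ : ℝ} (hμ : μ ≠ 0) {A a : ℤ → ℝ → ℂ} (hA : IsReversible A)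
    (h : ∀ p Z, A p Z = a p (μ * Z)) : IsReversible a := fun p hp x => by
  have hx := hA p hp (μ⁻¹ * x)
  rwa [h, h, mul_neg, mul_inv_cancel_left₀ hμ] at hx

/-! ### Solutions in the slow variable -/

section Slow

variable {s : ℝ}

/-- The pair `A(Z) = μ a(μ Z)`, `B(Z) = -μ b(μ Z)`, for `x = (a, b)` a pair of Fourier densities in
the slow variable: the scaling in which `slowDefect` measures the failure of the coupled mode
system. -/
noncomputable def slowPair (μ : ℝ) (x : reversibleDensity s × reversibleDensity s) :
    (ℤ → ℝ → ℂ) × (ℤ → ℝ → ℂ) :=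
  (fun p Z => modes ((μ • x.1 : reversibleDensity s) : SobolevDensity s) p (μ * Z),
    fun p Z => modes ((-μ • x.2 : reversibleDensity s) : SobolevDensity s) p (μ * Z))

lemma xNorm_modes_add_mul (hs : 1 < s) (c : ℝ) (f w : reversibleDensity s) :
    xNorm s (fun p ζ => modes (f : SobolevDensity s) p ζ
      + c * modes (w : SobolevDensity s) p ζ) = ‖f + c • w‖ₑ := by
  refine Eq.trans (congrArg (xNorm s) ?_) (xNorm_modes hs (f + c • w).2)
  ext p ζ
  rw [← modes_sobolevDensity_smul]
  exact (modes_sobolevDensity_add hs f (c • w : SobolevDensity s) p ζ).symm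

lemma enorm_add_enorm_le_ofReal_iff {E : Type*} [SeminormedAddCommGroup E] {x y : E} {δ : ℝ}
    (hδ : 0 ≤ δ) : ‖x‖ₑ + ‖y‖ₑ ≤ ENNReal.ofReal δ ↔ ‖x‖ + ‖y‖ ≤ δ := by
  rw [← ofReal_norm, ← ofReal_norm, ← ENNReal.ofReal_add (norm_nonneg x) (norm_nonneg y),
    ENNReal.ofReal_le_ofReal_iff hδ]

lemma xNorm_slow_le_iff (hs : 1 < s) {μ C : ℝ} (hμ : μ ≠ 0) (hC : 0 ≤ C)
    (w a b : reversibleDensity s) :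
    xNorm s (fun p ζ => modes ((μ • a : reversibleDensity s) : SobolevDensity s) p ζ
        - μ * modes (w : SobolevDensity s) p ζ)
      + xNorm s (fun p ζ => modes ((-μ • b : reversibleDensity s) : SobolevDensity s) p ζ
        + μ * modes (w : SobolevDensity s) p ζ) ≤ ENNReal.ofReal (C * μ ^ 2)
    ↔ ‖a - w‖ + ‖b - w‖ ≤ C * |μ| := by
  have hsub := xNorm_modes_add_mul hs (-μ) (μ • a) w
  simp only [Complex.ofReal_neg, neg_mul, ← sub_eq_add_neg] at hsub
  rw [hsub, xNorm_modes_add_mul hs, enorm_add_enorm_le_ofReal_iff (by positivity),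
    show μ • a + -μ • w = μ • (a - w) by module, show -μ • b + μ • w = -μ • (b - w) by module,
    norm_smul, norm_smul, norm_neg, Real.norm_eq_abs, ← mul_add, ← sq_abs μ,
    show C * |μ| ^ 2 = |μ| * (C * |μ|) by ring, mul_le_mul_iff_right₀ (abs_pos.2 hμ)]

theorem slow_solution_iff_exists_slowPair (hs : 1 < s) (Γ : ℝ) {μ C : ℝ} (hμ : μ ≠ 0)
    (hμ₁ : |μ| ≤ 1) (hC : 0 ≤ C) (w : reversibleDensity s) (AB : (ℤ → ℝ → ℂ) × (ℤ → ℝ → ℂ)) :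
    (MemX s AB.1 ∧ MemX s AB.2 ∧ IsCoupledModeSolution Γ √(1 - μ ^ 2) AB.1 AB.2 ∧
      IsReversible AB.1 ∧ IsReversible AB.2 ∧
      SlowClose s μ (modes (w : SobolevDensity s)) AB.1 AB.2 (C * μ ^ 2)) ↔
    ∃ x : reversibleDensity s × reversibleDensity s, AB = slowPair μ x ∧
      slowDefect (filteredCubic hs isReversibleSymbol_angularSymbol)
        (filteredCubic hs isReversibleSymbol_mixedSymbol) (Γ / 3) μ x = 0 ∧
      ‖x.1 - w‖ + ‖x.2 - w‖ ≤ C * |μ| := by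
  constructor
  · rintro ⟨-, -, hsol, hA, hB, a, b, ha, hb, hAa, hBb, hle⟩
    obtain ⟨f, rfl⟩ := exists_modes_eq_of_memX hs ha (hA.of_comp_mul hμ hAa)
    obtain ⟨g, rfl⟩ := exists_modes_eq_of_memX hs hb (hB.of_comp_mul hμ hBb)
    obtain ⟨f, rfl⟩ : ∃ f', μ • f' = f := ⟨μ⁻¹ • f, smul_inv_smul₀ hμ f⟩
    obtain ⟨g, rfl⟩ : ∃ g', -μ • g' = g :=
      ⟨(-μ)⁻¹ • g, smul_inv_smul₀ (neg_ne_zero.2 hμ) g⟩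
    obtain rfl : AB = slowPair μ (f, g) :=
      Prod.ext (funext₂ hAa) (funext₂ hBb)
    exact ⟨(f, g), rfl, (isCoupledModeSolution_iff_slowDefect hs Γ hμ hμ₁ (f, g)).1 hsol,
      (xNorm_slow_le_iff hs hμ hC w f g).1 hle⟩
  · rintro ⟨x, rfl, hx, hxw⟩
    exact ⟨memX_modes_comp_mul hs (μ • x.1).2 hμ hμ₁, memX_modes_comp_mul hs (-μ • x.2).2 hμ hμ₁,
      (isCoupledModeSolution_iff_slowDefect hs Γ hμ hμ₁ x).2 hx,
      isReversible_modes_comp_mul _ μ, isReversible_modes_comp_mul _ μ,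
      modes (μ • x.1 : reversibleDensity s), modes (-μ • x.2 : reversibleDensity s),
      memX_modes hs (μ • x.1).2, memX_modes hs (-μ • x.2).2, fun _ _ => rfl, fun _ _ => rfl,
      (xNorm_slow_le_iff hs hμ hC w x.1 x.2).2 hxw⟩

/-! ### The value `μ = 0` of the parameter -/

lemma MemX.eq_zero_of_const (hs : 1 < s) {A : ℤ → ℝ → ℂ} (hA : MemX s A) (hrev : IsReversible A)
    {a : ℤ → ℂ} (h : ∀ p Z, A p Z = a p) : A = 0 := by
  obtain ⟨f, rfl⟩ := exists_modes_eq_of_memX hs hA hrev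
  ext p Z
  rw [h p Z]
  refine tendsto_nhds_unique ?_ (tendsto_fourierInv_cocompact fun η : ℝ =>
    ((f : SobolevDensity s) (p, η) : ℂ))
  exact tendsto_const_nhds.congr fun Z => (h p Z).symm

lemma modes_sobolevDensity_zero : modes (0 : SobolevDensity s) = 0 := by
  ext p x
  simpa using modes_sobolevDensity_smul 0 (0 : SobolevDensity s) p x

lemma isCoupledModeSolution_zero (Γ Ω : ℝ) : IsCoupledModeSolution Γ Ω 0 0 := by
  constructor <;> simp [cubic]

theorem existsUnique_solution_zero (hs : 1 < s) (Γ C : ℝ) (U : ℤ → ℝ → ℂ) :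
    ∃! AB : (ℤ → ℝ → ℂ) × (ℤ → ℝ → ℂ), MemX s AB.1 ∧ MemX s AB.2 ∧
      IsCoupledModeSolution Γ √(1 - 0 ^ 2) AB.1 AB.2 ∧
      IsReversible AB.1 ∧ IsReversible AB.2 ∧ SlowClose s 0 U AB.1 AB.2 (C * 0 ^ 2) := by
  have hX : MemX s 0 := by
    rw [← modes_sobolevDensity_zero]
    exact memX_modes hs (zero_mem _)
  have hnorm : xNorm s (fun _ _ => 0) = 0 := by
    change xNorm s 0 = 0
    rw [← modes_sobolevDensity_zero, xNorm_modes hs (zero_mem _), enorm_zero]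
  have hrev : IsReversible 0 := fun p _ x => by simp
  have hclose : SlowClose s 0 U 0 0 (C * 0 ^ 2) := by
    refine ⟨0, 0, hX, hX, fun _ _ => rfl, fun _ _ => rfl, ?_⟩
    simp [hnorm]
  refine ⟨0, ⟨hX, hX, isCoupledModeSolution_zero Γ _, hrev, hrev, hclose⟩, ?_⟩
  rintro ⟨A, B⟩ ⟨hA, hB, -, hArev, hBrev, a, b, -, -, hAa, hBb, -⟩
  refine Prod.ext (hA.eq_zero_of_const hs hArev (a := fun p => a p 0) fun p Z => ?_)
    (hB.eq_zero_of_const hs hBrev (a := fun p => b p 0) fun p Z => ?_)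
  · rw [hAa, zero_mul]
  · rw [hBb, zero_mul]

end Slow

end GapSoliton

theorem theorem1 (s : ℝ) (hs : 1 < s) (Γ : ℝ) (U : ℤ → ℝ → ℂ)
    (hU : GapSoliton.MemX s U)
    (hUsol : GapSoliton.IsNLSSolution Γ U)
    (hUrev : GapSoliton.IsReversible U)
    (hinv : GapSoliton.LinearizationInvertible s Γ U) :
    ∃ μ₀ : ℝ, 0 < μ₀ ∧ ∃ C : ℝ, 0 < C ∧ ∀ μ : ℝ, |μ| < μ₀ →
      ∃! AB : (ℤ → ℝ → ℂ) × (ℤ → ℝ → ℂ),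
        GapSoliton.MemX s AB.1 ∧ GapSoliton.MemX s AB.2 ∧
        GapSoliton.IsCoupledModeSolution Γ (Real.sqrt (1 - μ ^ 2)) AB.1 AB.2 ∧
        GapSoliton.IsReversible AB.1 ∧ GapSoliton.IsReversible AB.2 ∧
        GapSoliton.SlowClose s μ U AB.1 AB.2 (C * μ ^ 2) := by
  obtain ⟨w, rfl⟩ := GapSoliton.exists_modes_eq_of_memX hs hU hUrev
  obtain ⟨C, hC, μ₀, hμ₀, hbranch⟩ := GapSoliton.exists_branch
    (GapSoliton.contDiff_filteredCubic hs GapSoliton.isReversibleSymbol_angularSymbol)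
    (GapSoliton.contDiff_filteredCubic hs GapSoliton.isReversibleSymbol_mixedSymbol)
    (GapSoliton.eq_smul_filteredCubic_of_isNLSSolution hs hUsol)
    ((GapSoliton.hasFDerivAt_filteredCubic hs
      GapSoliton.isReversibleSymbol_angularSymbol w).fun_const_smul _)
    (GapSoliton.bijective_sub_filteredCubicDeriv hs hinv)
  refine ⟨min μ₀ 1, lt_min hμ₀ one_pos, C, hC, fun μ hμ => ?_⟩
  obtain ⟨hμ₀, hμ₁⟩ := lt_min_iff.1 hμ
  obtain rfl | hμ := eq_or_ne μ 0
  · exact GapSoliton.existsUnique_solution_zero hs Γ C _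
  obtain ⟨x, hx, hunique⟩ := hbranch μ hμ₀
  simp only [GapSoliton.slow_solution_iff_exists_slowPair hs Γ hμ hμ₁.le hC.le]
  exact ⟨GapSoliton.slowPair μ x, ⟨x, rfl, hx⟩, fun AB ⟨y, hAB, hy⟩ => by rw [hAB, hunique y hy]⟩
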